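/- **Setting.** Let $K$ be a commutative ring. For a sequence or a polynomial $A$ and $a\le b$, write $A_{[a..b[}$ for the size-$(b-a)$ polynomial $\sum_{i<b-a}A_{a+i}X^i$ (a polynomial has size $n$ if its degree is less than $n$). For $A$ of size $m+n-1$ and $B$ of size $n$ let $\mathrm{MP}(A,B)=(AB \operatorname{div} X^{n-1})\bmod X^m$ (middle product), and for $A,B$ of size $n$ let $\mathrm{SP}(A,B)=AB\bmod X^n$ (short product). Let $M:\mathbb N\to\mathbb R$ be positive on $n\ge 1$ with $\alpha M(m)\le M(\alpha m)$ for all $m \ge 1$ and real $\alpha\ge1$ with $\alpha m$ an integer. Fix constants $\lambda_m,\lambda_s\ge1$, $\lambda_i\ge0$, $c_m,c_s\ge0$ and $0\le c_i\le\frac12\max(c_m,c_s+1)$. *Machine.* A program has two read-only input arrays, an output array that may be read and written, a work space, and a constant number of extra locations. A register contains an element of $K$ or a pointer (an integer that is bounded linearly in the size). Only operations in $K$ ($+,-,\times$, inversion of a unit) are counted. The extra space is the number of memory locations, pointers included, besides the inputs and the output. Given are programs for the following tasks, for all sizes $m\ge1$: * middle products in size $(2m-1,m)$, with at most $\lambda_mM(m)$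 operations and $c_mm+O(1)$ extra space; * short products in size $m$, with at most $\lambda_sM(m)$ operations and $c_sm+O(1)$ extra space; * $\mathrm{Inv}(G)=G^{-1}\bmod X^m$, with at most $\lambda_iM(m)$ operations and $c_im+O(1)$ extra space. **Algorithm InPlacePSDiv.** Input: $F,G$ of size $n\ge1$ with $G_0$ invertible. Output: $Q$ of size $n$. 1. $k\leftarrow\lfloor n/\max(c_i+1,c_s+2)\rfloor$; if $k>0$: $Q_{[n-k..n[}\leftarrow\mathrm{rev}(\mathrm{Inv}(G_{[0..k[}))$ with work space $Q_{[0..n-k[}$, then $Q_{[0..k[}\leftarrow\mathrm{SP}(F_{[0..k[},\mathrm{rev}(Q_{[n-k..n[}))$ with work space $Q_{[k..n-k[}$. 2. $\ell\leftarrow\lfloor (n-k)/(3+\max(c_m,c_s))\rfloor$. While $\ell>0$: $Q_{[n-2\ell..n-\ell[}\leftarrow\mathrm{MP}(G_{[1..k+\ell[},Q_{[0..k[})$ with work space $Q_{[k..n-2\ell[}$, computed by $\lceil k/\ell\rceil$ middle products in size $(2\ell-1,\ell)$ whose results are added up; $Q_{[n-2\ell..n-\ell[}\leftarrow F_{[k..k+\ell[}-Q_{[n-2\ell..n-\ell[}$;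 $Q_{[k..k+\ell[}\leftarrow\mathrm{SP}(Q_{[n-2\ell..n-\ell[},\mathrm{rev}(Q_{[n-\ell..n[}))$ with work space $Q_{[k+\ell..n-2\ell[}$; $k\leftarrow k+\ell$; $\ell\leftarrow\lfloor (n-k)/(3+\max(c_m,c_s))\rfloor$. 3. In constant extra space: $tmp\leftarrow F_{[k..n[}-\mathrm{MP}(G_{[1..n[},Q_{[0..k[})$, with the middle product computed by inner products, and $Q_{[k..n[}\leftarrow\mathrm{SP}(tmp,\mathrm{Inv}(G_{[0..n-k[}))$. **Theorem.** (a) (Generalized Karp–Markstein step.) Let $F,G\in K[[X]]$ and $0<\ell\le k$. If $Q$ has size $k$ and $GQ\equiv F\bmod X^k$, and $H$ has size $\ell$ and $GH\equiv1\bmod X^\ell$, then $$G\cdot\bigl(Q+X^k\,\mathrm{SP}(H,\,F_{[k..k+\ell[}-\mathrm{MP}(G_{[1..k+\ell[},Q))\bigr)\equiv F\bmod X^{k+\ell}.$$ (b) Algorithm InPlacePSDiv is correct: for all $n\ge1$ and all $F,G$ of size $n$ with $G_0$ invertible, it computes $Q$ of size $n$ with $GQ\equiv F\bmod X^n$, that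 is, $Q = F/G \bmod X^n$. It uses $O(1)$ extra space. (c) Its number of operations in $K$ is at most $$\lambda_m\,M(n)\,\log_{\frac{c+3}{c+2}}(n)+O(M(n)),\qquad c=\max(c_m,c_s),$$ whenever $n\log n=O(M(n))$, in particular for quasi-linear $M$ such as $n\log n$ or $n\log n\log\log n$ up to constants. If $c_s\le c_m$, the base of the logarithm is $\frac{c_m+3}{c_m+2}$. (d) Its number of operations in $K$ is $O(M(n))$ if $M(n)=\Theta(n^{1+\gamma})$ with $0<\gamma\le1$. The constants in $O(\cdot)$ do not depend on $n$, $F$, $G$. -/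

import Mathlib

open Polynomial Filter Asymptotics

namespace PSDiv

/-! ### Chunks, middle products and short products -/

/-- The chunk `f_[a..b[`, stored as a polynomial of size `b - a`: the coefficients of index
`a, …, b - 1` of the coefficient sequence `f`. -/
noncomputable def chunk {K : Type*} [CommRing K] (f : ℕ → K) (a b : ℕ) : K[X] :=
  ∑ i ∈ Finset.range (b - a), monomial i (f (a + i))

/-- The middle product in size `(m + n - 1, n)`: `(A * B div X^(n-1)) mod X^m`. -/
noncomputable def middleProduct {K : Type*} [CommRing K] (m n : ℕ) (A B : K[X]) : K[X] :=
  chunk (A * B).coeff (n - 1) (n - 1 + m)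

/-- The short product in size `n`: `A * B mod X^n`. -/
noncomputable def shortProduct {K : Type*} [CommRing K] (n : ℕ) (A B : K[X]) : K[X] :=
  chunk (A * B).coeff 0 n

/-! ### The machine

A routine works on five arrays of registers: two read-only inputs, an output that can be read and
written, a work space and a fixed number of extra registers. A register contains either a ring
element or a pointer. Besides, a routine has finitely many index registers, which contain pointers;
pointers are natural numbers bounded by a word bound `B`. Only the operations in the ring are
counted. -/

/-- The arrays seen by a routine. -/
inductive Arr
  | in₁ | in₂ | out | work | extra
  deriving DecidableEq

/-- Input space is read-only. -/
def Arr.Writable : Arr → Prop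
  | .in₁ => False
  | .in₂ => False
  | .out => True
  | .work => True
  | .extra => True

/-- The content of a register: a ring element or a pointer. -/
inductive Cell (K : Type*)
  | elt (a : K)
  | ptr (i : ℕ)

/-- Index expressions over the index registers. -/
inductive IExp
  | reg (r : ℕ)
  | const (a : ℕ)
  | add (e f : IExp)
  | sub (e f : IExp)
  | mul (e f : IExp)
  | mod (e f : IExp)
  | floorMul (c : ℝ) (e : IExp)
  | floorDiv (e : IExp) (c : ℝ)

/-- Value of an index expression; subtraction is truncated. -/
noncomputable def IExp.eval (ρ : ℕ → ℕ) : IExp → ℕ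
  | .reg r => ρ r
  | .const a => a
  | .add e f => e.eval ρ + f.eval ρ
  | .sub e f => e.eval ρ - f.eval ρ
  | .mul e f => e.eval ρ * f.eval ρ
  | .mod e f => e.eval ρ % f.eval ρ
  | .floorMul c e => ⌊c * (e.eval ρ : ℝ)⌋₊
  | .floorDiv e c => ⌊(e.eval ρ : ℝ) / c⌋₊

/-- A segment of `len` consecutive registers of an array, read forwards or backwards. -/
structure Slice where
  arr : Arr
  start : ℕ
  len : ℕ
  rev : Bool

/-- Position in the array of the `i`-th register of a slice. -/
def Slice.pos (s : Slice) (i : ℕ) : ℕ :=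
  if s.rev then s.start + s.len - 1 - i else s.start + i

/-- Rank in the slice of the register at position `j` of the array. -/
def Slice.rank (s : Slice) (j : ℕ) : ℕ :=
  if s.rev then s.start + s.len - 1 - j else j - s.start

/-- Two slices have no register in common. -/
def Slice.Disjoint (s t : Slice) : Prop :=
  s.arr ≠ t.arr ∨ s.start + s.len ≤ t.start ∨ t.start + t.len ≤ s.start

/-- Overwrite the registers of a slice. -/
def Slice.write {K : Type*} (s : Slice) (v : ℕ → Cell K) (μ : Arr → ℕ → Cell K) :
    Arr → ℕ → Cell K :=
  fun b j => if b = s.arr ∧ s.start ≤ j ∧ j < s.start + s.len then v (s.rank j) else μ b j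

/-- A slice whose bounds are index expressions. -/
structure View where
  arr : Arr
  start : IExp
  len : IExp
  rev : Bool

noncomputable def View.eval (ρ : ℕ → ℕ) (v : View) : Slice :=
  ⟨v.arr, v.start.eval ρ, v.len.eval ρ, v.rev⟩

/-- The binary ring operations. -/
inductive Op
  | add | sub | mul

def Op.eval {K : Type*} [CommRing K] : Op → K → K → K
  | .add, a, b => a + b
  | .sub, a, b => a - b
  | .mul, a, b => a * b

/-- Programs. `call p m args` runs the program `p` for the size `m`, with fresh index registers and
with the array `a` of `p` being the slice `args a` of the arrays of the caller. -/
inductive Cmd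
  | skip
  | seq (c d : Cmd)
  | assign (r : ℕ) (e : IExp)
  | load (r : ℕ) (a : Arr) (e : IExp)
  | store (a : Arr) (e v : IExp)
  | zero (a : Arr) (e : IExp)
  | one (a : Arr) (e : IExp)
  | copy (a : Arr) (e : IExp) (b : Arr) (f : IExp)
  | arith (o : Op) (a : Arr) (e : IExp) (b : Arr) (f : IExp) (b' : Arr) (f' : IExp)
  | inv (a : Arr) (e : IExp) (b : Arr) (f : IExp)
  | cond (e : IExp) (c d : Cmd)
  | loop (e : IExp) (c : Cmd)
  | call (p : Cmd) (m : IExp) (args : Arr → View)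

/-- Contents of all registers. -/
structure Store (K : Type*) where
  mem : Arr → ℕ → Cell K
  idx : ℕ → ℕ

def Store.setIdx {K : Type*} (σ : Store K) (r v : ℕ) : Store K :=
  ⟨σ.mem, Function.update σ.idx r v⟩

def Store.setCell {K : Type*} (σ : Store K) (a : Arr) (i : ℕ) (v : Cell K) : Store K :=
  ⟨Function.update σ.mem a (Function.update (σ.mem a) i v), σ.idx⟩

/-- Index registers at the start of a routine: register `0` contains the size. -/
def initIdx (m : ℕ) : ℕ → ℕ := fun r => if r = 0 then m else 0

/-- `Exec B len c σ τ t`: with word bound `B` and arrays of lengths `len`, the program `c` started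
in `σ` halts in `τ` after `t` operations in the ring. An access outside the arrays, a write to an
input, a pointer above the word bound, an operation on registers that do not contain ring elements,
the inversion of a non-unit, or a call whose writable arrays are not disjoint from all the other
arrays passed, has no execution. -/
inductive Exec {K : Type*} [CommRing K] (B : ℕ) :
    (Arr → ℕ) → Cmd → Store K → Store K → ℕ → Prop
  | skip {len : Arr → ℕ} {σ : Store K} : Exec B len .skip σ σ 0
  | seq {len : Arr → ℕ} {c d : Cmd} {σ τ υ : Store K} {s t : ℕ} :
      Exec B len c σ τ s → Exec B len d τ υ t → Exec B len (.seq c d) σ υ (s + t)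
  | assign {len : Arr → ℕ} {r : ℕ} {e : IExp} {σ : Store K} :
      e.eval σ.idx ≤ B → Exec B len (.assign r e) σ (σ.setIdx r (e.eval σ.idx)) 0
  | load {len : Arr → ℕ} {r : ℕ} {a : Arr} {e : IExp} {σ : Store K} {v : ℕ} :
      e.eval σ.idx < len a → σ.mem a (e.eval σ.idx) = .ptr v → v ≤ B →
      Exec B len (.load r a e) σ (σ.setIdx r v) 0
  | store {len : Arr → ℕ} {a : Arr} {e v : IExp} {σ : Store K} :
      a.Writable → e.eval σ.idx < len a → v.eval σ.idx ≤ B →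
      Exec B len (.store a e v) σ (σ.setCell a (e.eval σ.idx) (.ptr (v.eval σ.idx))) 0
  | zero {len : Arr → ℕ} {a : Arr} {e : IExp} {σ : Store K} :
      a.Writable → e.eval σ.idx < len a →
      Exec B len (.zero a e) σ (σ.setCell a (e.eval σ.idx) (.elt 0)) 0
  | one {len : Arr → ℕ} {a : Arr} {e : IExp} {σ : Store K} :
      a.Writable → e.eval σ.idx < len a →
      Exec B len (.one a e) σ (σ.setCell a (e.eval σ.idx) (.elt 1)) 0
  | copy {len : Arr → ℕ} {a b : Arr} {e f : IExp} {σ : Store K} :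
      a.Writable → e.eval σ.idx < len a → f.eval σ.idx < len b →
      Exec B len (.copy a e b f) σ (σ.setCell a (e.eval σ.idx) (σ.mem b (f.eval σ.idx))) 0
  | arith {len : Arr → ℕ} {o : Op} {a b b' : Arr} {e f f' : IExp} {σ : Store K} {u v : K} :
      a.Writable → e.eval σ.idx < len a → f.eval σ.idx < len b → f'.eval σ.idx < len b' →
      σ.mem b (f.eval σ.idx) = .elt u → σ.mem b' (f'.eval σ.idx) = .elt v →
      Exec B len (.arith o a e b f b' f') σ (σ.setCell a (e.eval σ.idx) (.elt (o.eval u v))) 1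
  | inv {len : Arr → ℕ} {a b : Arr} {e f : IExp} {σ : Store K} {u : Kˣ} :
      a.Writable → e.eval σ.idx < len a → f.eval σ.idx < len b →
      σ.mem b (f.eval σ.idx) = .elt (u : K) →
      Exec B len (.inv a e b f) σ (σ.setCell a (e.eval σ.idx) (.elt ((u⁻¹ : Kˣ) : K))) 1
  | cond_true {len : Arr → ℕ} {e : IExp} {c d : Cmd} {σ τ : Store K} {t : ℕ} :
      e.eval σ.idx ≠ 0 → Exec B len c σ τ t → Exec B len (.cond e c d) σ τ t
  | cond_false {len : Arr → ℕ} {e : IExp} {c d : Cmd} {σ τ : Store K} {t : ℕ} :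
      e.eval σ.idx = 0 → Exec B len d σ τ t → Exec B len (.cond e c d) σ τ t
  | loop_done {len : Arr → ℕ} {e : IExp} {c : Cmd} {σ : Store K} :
      e.eval σ.idx = 0 → Exec B len (.loop e c) σ σ 0
  | loop_step {len : Arr → ℕ} {e : IExp} {c : Cmd} {σ τ υ : Store K} {s t : ℕ} :
      e.eval σ.idx ≠ 0 → Exec B len c σ τ s → Exec B len (.loop e c) τ υ t →
      Exec B len (.loop e c) σ υ (s + t)
  | call {len : Arr → ℕ} {p : Cmd} {m : IExp} {args : Arr → View} {σ τ : Store K} {t : ℕ}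
      {s : Arr → Slice} :
      (∀ a, s a = (args a).eval σ.idx) →
      (∀ a, (s a).start + (s a).len ≤ len (s a).arr) →
      (∀ a, a.Writable → (s a).arr.Writable) →
      (∀ a b, a.Writable → a ≠ b → (s a).Disjoint (s b)) →
      m.eval σ.idx ≤ B →
      Exec B (fun a => (s a).len) p
        ⟨fun a i => σ.mem (s a).arr ((s a).pos i), initIdx (m.eval σ.idx)⟩ τ t →
      Exec B len (.call p m args) σ
        ⟨(s .extra).write (τ.mem .extra) ((s .work).write (τ.mem .work)
          ((s .out).write (τ.mem .out) σ.mem)), σ.idx⟩ t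

/-- Number of index registers of a program, those of the called programs not included. -/
def Cmd.ownRegs : Cmd → ℕ
  | .seq c d => max c.ownRegs d.ownRegs
  | .assign r _ => r + 1
  | .load r _ _ => r + 1
  | .cond _ c d => max c.ownRegs d.ownRegs
  | .loop _ c => c.ownRegs
  | _ => 1

/-- Maximal number of index registers simultaneously in use in called programs. -/
def Cmd.calleeRegs : Cmd → ℕ
  | .seq c d => max c.calleeRegs d.calleeRegs
  | .cond _ c d => max c.calleeRegs d.calleeRegs
  | .loop _ c => c.calleeRegs
  | .call p _ _ => p.ownRegs + p.calleeRegs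
  | _ => 0

/-- Number of index registers used by a program. -/
def Cmd.regs (c : Cmd) : ℕ := c.ownRegs + c.calleeRegs

/-- A program together with its fixed number of extra registers. -/
structure Routine where
  code : Cmd
  extra : ℕ

/-- Lengths of the five arrays. -/
def shape (l₁ l₂ l w e : ℕ) : Arr → ℕ
  | .in₁ => l₁
  | .in₂ => l₂
  | .out => l
  | .work => w
  | .extra => e

/-- The first `m` registers of the array `a` contain the size-`m` polynomial `P`. -/
def Holds {K : Type*} [CommRing K] (μ : Arr → ℕ → Cell K) (a : Arr) (m : ℕ) (P : K[X]) : Prop :=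
  P.degree < (m : WithBot ℕ) ∧ ∀ i < m, μ a i = .elt (P.coeff i)

/-- `p` computes the middle product in size `(2m - 1, m)`, for all `m ≥ 1`, with at most `time m`
operations and extra space `⌊c m⌋ + O(1)`, with pointers of value `O(m)`. All registers except
the inputs may contain anything initially. -/
def IsMiddleProduct (K : Type*) [CommRing K] (p : Routine) (time : ℕ → ℝ) (c : ℝ) : Prop :=
  ∃ b : ℕ, ∀ m : ℕ, 1 ≤ m → ∀ B : ℕ, b * (m + 1) ≤ B →
    ∀ (μ : Arr → ℕ → Cell K) (P R : K[X]), Holds μ .in₁ (2 * m - 1) P → Holds μ .in₂ m R →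
      ∃ (τ : Store K) (t : ℕ),
        Exec B (shape (2 * m - 1) m m ⌊c * (m : ℝ)⌋₊ p.extra) p.code ⟨μ, initIdx m⟩ τ t ∧
        Holds τ.mem .out m (middleProduct m m P R) ∧ (t : ℝ) ≤ time m

/-- `p` computes the short product in size `m`, for all `m ≥ 1`, with at most `time m` operations
and extra space `⌊c m⌋ + O(1)`. -/
def IsShortProduct (K : Type*) [CommRing K] (p : Routine) (time : ℕ → ℝ) (c : ℝ) : Prop :=
  ∃ b : ℕ, ∀ m : ℕ, 1 ≤ m → ∀ B : ℕ, b * (m + 1) ≤ B →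
    ∀ (μ : Arr → ℕ → Cell K) (P R : K[X]), Holds μ .in₁ m P → Holds μ .in₂ m R →
      ∃ (τ : Store K) (t : ℕ),
        Exec B (shape m m m ⌊c * (m : ℝ)⌋₊ p.extra) p.code ⟨μ, initIdx m⟩ τ t ∧
        Holds τ.mem .out m (shortProduct m P R) ∧ (t : ℝ) ≤ time m

/-- `p` computes the power series inverse at precision `m`, for all `m ≥ 1`, with at most `time m`
operations and extra space `⌊c m⌋ + O(1)`. -/
def IsInversion (K : Type*) [CommRing K] (p : Routine) (time : ℕ → ℝ) (c : ℝ) : Prop :=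
  ∃ b : ℕ, ∀ m : ℕ, 1 ≤ m → ∀ B : ℕ, b * (m + 1) ≤ B →
    ∀ (μ : Arr → ℕ → Cell K) (P : K[X]), Holds μ .in₁ m P → IsUnit (P.coeff 0) →
      ∃ (τ : Store K) (t : ℕ) (R : K[X]),
        Exec B (shape m 0 m ⌊c * (m : ℝ)⌋₊ p.extra) p.code ⟨μ, initIdx m⟩ τ t ∧
        Holds τ.mem .out m R ∧ X ^ m ∣ P * R - 1 ∧ (t : ℝ) ≤ time m

/-- `p` computes the power series quotient `F / G` at precision `n`, for all `n ≥ 1` and all `F`, `G`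
of size `n` such that `G_[0]` is invertible, with at most `time n` operations, with at most `space n`
memory locations (index registers included) besides the read-only inputs and the output, and with
pointers of value `O(n)`. -/
def IsDivision (K : Type*) [CommRing K] (p : Routine) (space time : ℕ → ℕ) : Prop :=
  ∃ b : ℕ, ∀ n : ℕ, 1 ≤ n → ∃ w : ℕ, w + p.extra + p.code.regs ≤ space n ∧
    ∀ B : ℕ, b * (n + 1) ≤ B →
    ∀ (μ : Arr → ℕ → Cell K) (F G : K[X]), Holds μ .in₁ n F → Holds μ .in₂ n G →
      IsUnit (G.coeff 0) →
      ∃ (τ : Store K) (t : ℕ) (Q : K[X]),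
        Exec B (shape n n n w p.extra) p.code ⟨μ, initIdx n⟩ τ t ∧
        Holds τ.mem .out n Q ∧ X ^ n ∣ F - G * Q ∧ t ≤ time n

/-! ### The in-place division algorithm -/

namespace Alg

/-- Index registers of the algorithm: the size `n`, the current precision `k`, the number `ℓ` of new
coefficients, and the counters `i`, `j`, `r`. -/
def n : IExp := .reg 0
def k : IExp := .reg 1
def ℓ : IExp := .reg 2
def i : IExp := .reg 3
def j : IExp := .reg 4
def r : IExp := .reg 5

/-- `for reg = 0, …, bound - 1 do c`. -/
def for' (reg : ℕ) (bound : IExp) (c : Cmd) : Cmd :=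
  .seq (.assign reg (.const 0))
    (.loop (.sub bound (.reg reg)) (.seq c (.assign reg (.add (.reg reg) (.const 1)))))

/-- `a_[start..start+len[`. -/
def fwd (a : Arr) (start len : IExp) : View := ⟨a, start, len, false⟩

/-- `rev (a_[start..start+len[)`. -/
def bwd (a : Arr) (start len : IExp) : View := ⟨a, start, len, true⟩

def args (x y z w e : View) : Arr → View
  | .in₁ => x
  | .in₂ => y
  | .out => z
  | .work => w
  | .extra => e

/-- Call of a routine for the size `m`, on the inputs `x` and `y`, with output `z`, and work space `w`;
its extra registers are the first ones of the caller. -/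
def run (p : Routine) (m : IExp) (x y z w : View) : Cmd :=
  .call p.code m (args x y z w (fwd .extra (.const 0) (.const p.extra)))

/-- The position `n - 2ℓ`. -/
def d : IExp := .sub n (.mul (.const 2) ℓ)

/-- `Q_[n-2ℓ..n-ℓ[ ← MP(G_[1..k+ℓ[, Q_[0..k[)`, with work space `Q_[k..n-2ℓ[`, by `⌈k/ℓ⌉` middle
products in size `(2ℓ - 1, ℓ)`. If `r = k mod ℓ` is not zero, the first one deals with `Q_[0..r[`,
padded with zeros in `Q_[k..k+ℓ[`. The results of the others are computed in `Q_[k..k+ℓ[` and added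
to `Q_[n-2ℓ..n-ℓ[`. -/
noncomputable def unbalancedMP (mp : Routine) (cm : ℝ) : Cmd :=
  .seq (.assign 5 (.mod k ℓ)) <|
  .seq (.cond r
    (.seq
      (for' 3 ℓ (.cond (.sub (.sub ℓ r) i)
        (.zero .out (.add k i))
        (.copy .out (.add k i) .out (.sub i (.sub ℓ r)))))
      (run mp ℓ
        (fwd .in₂ (.sub (.add k (.const 1)) r) (.sub (.mul (.const 2) ℓ) (.const 1)))
        (fwd .out k ℓ)
        (fwd .out d ℓ)
        (fwd .out (.add k ℓ) (.floorMul cm ℓ))))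
    (for' 3 ℓ (.zero .out (.add d i)))) <|
  .seq (.assign 4 r) <|
  .loop (.sub k j) <|
    .seq (run mp ℓ
      (fwd .in₂ (.sub (.add k (.const 1)) (.add j ℓ)) (.sub (.mul (.const 2) ℓ) (.const 1)))
      (fwd .out j ℓ)
      (fwd .out k ℓ)
      (fwd .out (.add k ℓ) (.floorMul cm ℓ))) <|
    .seq (for' 3 ℓ (.arith .add .out (.add d i) .out (.add d i) .out (.add k i)))
      (.assign 4 (.add j ℓ))

/-- The first two steps: with `k = ⌊n / max (ci + 1) (cs + 2)⌋`,
`Q_[n-k..n[ ← rev (Inv(G_[0..k[))` and `Q_[0..k[ ← SP(F_[0..k[, rev Q_[n-k..n[)`. -/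
noncomputable def start (sp inv : Routine) (cs ci : ℝ) : Cmd :=
  .seq (.assign 1 (.floorDiv n (max (ci + 1) (cs + 2)))) <|
  .cond k
    (.seq
      (run inv k (fwd .in₂ (.const 0) k) (fwd .in₂ (.const 0) (.const 0)) (bwd .out (.sub n k) k)
        (fwd .out (.const 0) (.floorMul ci k)))
      (run sp k (fwd .in₁ (.const 0) k) (bwd .out (.sub n k) k) (fwd .out (.const 0) k)
        (fwd .out k (.floorMul cs k))))
    .skip

/-- `ℓ ← ⌊(n - k) / (3 + max cm cs)⌋`. -/
noncomputable def setℓ (cm cs : ℝ) : Cmd :=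
  .assign 2 (.floorDiv (.sub n k) (3 + max cm cs))

/-- One iteration of the main loop. -/
noncomputable def step (mp sp : Routine) (cm cs : ℝ) : Cmd :=
  .seq (unbalancedMP mp cm) <|
  .seq (for' 3 ℓ (.arith .sub .out (.add d i) .in₁ (.add k i) .out (.add d i))) <|
  .seq (run sp ℓ (fwd .out d ℓ) (bwd .out (.sub n ℓ) ℓ) (fwd .out k ℓ)
    (fwd .out (.add k ℓ) (.floorMul cs ℓ))) <|
  .seq (.assign 1 (.add k ℓ)) (setℓ cm cs)

/-- The last step, where `ℓ = n - k` is bounded by a constant: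
`tmp ← F_[k..n[ - MP(G_[1..n[, Q_[0..k[)` and `Q_[k..n[ ← SP(tmp, Inv(G_[0..n-k[))`. The extra register
`s` is a scratch register, the next `ℓ` ones contain `tmp`, the next `ℓ` ones the inverse, and the
following ones are work space. -/
noncomputable def finish (sp inv : Routine) (cs ci : ℝ) (s : ℕ) : Cmd :=
  .seq (.assign 2 (.sub n k)) <|
  .seq (run inv ℓ (fwd .in₂ (.const 0) ℓ) (fwd .in₂ (.const 0) (.const 0))
    (fwd .extra (.add (.const (s + 1)) ℓ) ℓ)
    (fwd .extra (.add (.const (s + 1)) (.mul (.const 2) ℓ)) (.floorMul ci ℓ))) <|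
  .seq (for' 3 ℓ
    (.seq (.copy .extra (.add (.const (s + 1)) i) .in₁ (.add k i))
      (for' 4 k
        (.seq (.arith .mul .extra (.const s) .in₂ (.sub (.add k i) j) .out j)
          (.arith .sub .extra (.add (.const (s + 1)) i)
            .extra (.add (.const (s + 1)) i) .extra (.const s)))))) <|
  run sp ℓ (fwd .extra (.const (s + 1)) ℓ) (fwd .extra (.add (.const (s + 1)) ℓ) ℓ) (fwd .out k ℓ)
    (fwd .extra (.add (.const (s + 1)) (.mul (.const 2) ℓ)) (.floorMul cs ℓ))

end Alg

/-- The in-place power series division built on the routines `mp`, `sp` and `inv`, whose extra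
spaces in size `m` are `cm m`, `cs m` and `ci m` up to constants. The inputs `F` and `G` are the
arrays `in₁` and `in₂`, and `Q` is the array `out`. -/
noncomputable def inPlacePSDiv (mp sp inv : Routine) (cm cs ci : ℝ) : Routine where
  code :=
    .seq (Alg.start sp inv cs ci) <|
    .seq (Alg.setℓ cm cs) <|
    .seq (.loop Alg.ℓ (Alg.step mp sp cm cs)) <|
    Alg.finish sp inv cs ci (max mp.extra (max sp.extra inv.extra))
  extra :=
    max mp.extra (max sp.extra inv.extra) + 1 + 2 * ⌈3 + max cm cs⌉₊
      + ⌊max ci cs * (⌈3 + max cm cs⌉₊ : ℝ)⌋₊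

end PSDiv

namespace PSDiv

/-! ### Coefficients of chunks and products -/

/-! Correctness rests on one identity. If `F = G * Q + X ^ k * E`, then `E` agrees modulo `X ^ l`
with the residual `D`, a chunk of `F` minus a middle product of `Q` with a chunk of `G`. If `G * H`
is `1` modulo `X ^ l`, then `H * D` is `E / G` modulo `X ^ l`, which supplies the next `l`
coefficients (`karpMarkstein`, and `exists_quotient_add` in the form used by the program).

The space bound is a matter of layout. The `n - k` registers still free in the output have room for
the `l` new coefficients, the `l` coefficients of the residual, `l` coefficients of the inverse and
`⌊c * l⌋` registers of work space, because `(3 + c) * l ≤ n - k`. The inverse is computed only once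
and kept reversed at the right end: a truncation of it is then again a segment ending at `n`, and
since `l` never increases nothing has to be recomputed or moved. The first `l` is at most the
initial precision by `newCoeffs_le_startCoeffs`. When `l` reaches `0`, fewer than `3 + c`
coefficients are missing, and constantly many extra registers suffice.

Programs are treated through `WP`, a total correctness predicate that also counts operations. The
specifications of the program parts record the contents that later parts need, with a frame
condition where needed.

For the cost, superlinearity of `M` makes `M m / m` nondecreasing, so the middle products of one
iteration, of total length at most `n`, cost at most `lm * M n`. An iteration removes about a
fraction `1 / (c + 3)` of the missing coefficients, hence the base `(c + 3) / (c + 2)` of the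
logarithm (`loopCost_le_log`). The short products telescope to `O(M n)`, and the linear work per
iteration is absorbed by `n log n = O(M n)`. If `M n` is of order `n ^ (1 + γ)`, an iteration costs
at most a constant times `n * x ^ γ` with `x` coefficients missing, and these costs are dominated by
a geometric series (`exists_loopCost_le_rpow`). -/

theorem coeff_chunk {K : Type*} [CommRing K] (f : ℕ → K) (a b i : ℕ) :
    (chunk f a b).coeff i = if i < b - a then f (a + i) else 0 := by
  simp [chunk, finsetSum_coeff, coeff_monomial]

theorem degree_chunk_lt {K : Type*} [CommRing K] (f : ℕ → K) (a b m : ℕ) (h : b - a ≤ m) :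
    (chunk f a b).degree < (m : WithBot ℕ) := by
  rw [degree_lt_iff_coeff_zero]
  intro i hi
  rw [coeff_chunk, if_neg (by omega)]

theorem coeff_shortProduct {K : Type*} [CommRing K] {n t : ℕ} (A B : K[X]) (ht : t < n) :
    (shortProduct n A B).coeff t = (A * B).coeff t := by
  rw [shortProduct, coeff_chunk, if_pos (by omega), zero_add]

/-- The condition `k ≤ N + 1` puts every index below `k` in the antidiagonal of `N`, so the
subtraction `N - u` is never truncated. -/
theorem coeff_mul_coe {K : Type*} [CommRing K] (G : PowerSeries K) {Q : K[X]} {k N : ℕ}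
    (hQ : Q.degree < (k : WithBot ℕ)) (hN : k ≤ N + 1) :
    PowerSeries.coeff N (G * (Q : PowerSeries K)) =
      ∑ u ∈ Finset.range k, PowerSeries.coeff (N - u) G * Q.coeff u := by
  rw [mul_comm, PowerSeries.coeff_mul, Finset.Nat.sum_antidiagonal_eq_sum_range_succ_mk]
  simp only [coeff_coe]
  rw [← Finset.sum_subset (Finset.range_mono hN)]
  · exact Finset.sum_congr rfl fun _ _ => mul_comm _ _
  · intro u _ hu
    rw [degree_lt_iff_coeff_zero] at hQ
    rw [hQ u (by simpa using hu), zero_mul]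

theorem coeff_middleProduct {K : Type*} [CommRing K] {m k t : ℕ} (A : K[X]) {Q : K[X]}
    (hQ : Q.degree < (k : WithBot ℕ)) (ht : t < m) :
    (middleProduct m k A Q).coeff t =
      ∑ u ∈ Finset.range k, A.coeff (k - 1 + t - u) * Q.coeff u := by
  rw [middleProduct, coeff_chunk, if_pos (by omega)]
  have h := coeff_mul_coe (A : PowerSeries K) hQ (N := k - 1 + t) (by omega)
  simpa only [← Polynomial.coe_mul, coeff_coe] using h

/-- The shift by `1` in the chunk compensates the `k - 1` in the middle product. As `u < k`, the
index `k + t - u` is at least `1`, so the constant coefficient of `g` is never needed. -/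
theorem coeff_middleProduct_chunk {K : Type*} [CommRing K] {l k t : ℕ} (g : ℕ → K) {Q : K[X]}
    (hQ : Q.degree < (k : WithBot ℕ)) (ht : t < l) :
    (middleProduct l k (chunk g 1 (k + l)) Q).coeff t =
      ∑ u ∈ Finset.range k, g (k + t - u) * Q.coeff u := by
  rw [coeff_middleProduct _ hQ ht]
  refine Finset.sum_congr rfl fun u hu => ?_
  have hu := Finset.mem_range.1 hu
  rw [coeff_chunk, if_pos (by omega)]
  congr 2
  omega

/-- The generalized Karp–Markstein step. -/
theorem karpMarkstein {K : Type*} [CommRing K] (F G : PowerSeries K) (k l : ℕ) (Q H : K[X])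
    (hQ : Q.degree < (k : WithBot ℕ))
    (hF : (PowerSeries.X : PowerSeries K) ^ k ∣ F - G * (Q : PowerSeries K))
    (hH : (PowerSeries.X : PowerSeries K) ^ l ∣ 1 - G * (H : PowerSeries K)) :
    (PowerSeries.X : PowerSeries K) ^ (k + l) ∣
      F - G * ((Q + X ^ k * shortProduct l H
        (chunk (fun i => PowerSeries.coeff i F) k (k + l)
          - middleProduct l k (chunk (fun i => PowerSeries.coeff i G) 1 (k + l)) Q) :
            K[X]) : PowerSeries K) := by
  set D : K[X] := chunk (fun i => PowerSeries.coeff i F) k (k + l)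
    - middleProduct l k (chunk (fun i => PowerSeries.coeff i G) 1 (k + l)) Q with hD
  set S := shortProduct l H D with hS
  obtain ⟨E, hE⟩ := hF
  -- Subtracting `G * Q` from `F` leaves in degrees `k` to `k + l - 1` exactly the coefficients of
  -- `D`.
  have hED : (PowerSeries.X : PowerSeries K) ^ l ∣ E - (D : PowerSeries K) := by
    rw [PowerSeries.X_pow_dvd_iff]
    intro t ht
    have h1 : PowerSeries.coeff (k + t) (F - G * (Q : PowerSeries K)) = PowerSeries.coeff t E := by
      rw [hE, add_comm k t, PowerSeries.coeff_X_pow_mul]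
    rw [map_sub, coeff_coe, hD, coeff_sub, coeff_chunk, if_pos (by omega),
      coeff_middleProduct_chunk _ hQ ht, ← h1, map_sub, coeff_mul_coe G hQ (by omega), sub_self]
  have hHD : (PowerSeries.X : PowerSeries K) ^ l ∣
      (H : PowerSeries K) * (D : PowerSeries K) - (S : PowerSeries K) := by
    rw [PowerSeries.X_pow_dvd_iff]
    intro t ht
    rw [map_sub, ← Polynomial.coe_mul, coeff_coe, coeff_coe, hS, coeff_shortProduct _ _ ht,
      sub_self]
  -- The new remainder is `X ^ k * (E - G * S)`. Inserting `D` and `G * H * D` splits the second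
  -- factor into three terms, each divisible by `X ^ l`.
  have key : F - G * ((Q + X ^ k * S : K[X]) : PowerSeries K) =
      PowerSeries.X ^ k * ((E - (D : PowerSeries K)) + (1 - G * (H : PowerSeries K)) * (D : PowerSeries K)
        + G * ((H : PowerSeries K) * (D : PowerSeries K) - (S : PowerSeries K))) := by
    have : F = G * (Q : PowerSeries K) + PowerSeries.X ^ k * E := by rw [← hE]; ring
    rw [this]
    push_cast
    ring
  rw [key, pow_add]
  exact mul_dvd_mul_left _ (dvd_add (dvd_add hED (hH.mul_right _)) (hHD.mul_left _))

/-! ### Slices -/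

section slices

variable {K : Type*}

/-- Writing one more register extends the written prefix of a segment; this is the inductive step of
the filling loops. -/
theorem setCell_write (a : Arr) (base i : ℕ) (v : ℕ → Cell K) (μ : Arr → ℕ → Cell K)
    (ρ : ℕ → ℕ) :
    (Store.mk ((Slice.mk a base i false).write v μ) ρ).setCell a (base + i) (v i) =
      ⟨(Slice.mk a base (i + 1) false).write v μ, ρ⟩ := by
  simp only [Store.setCell, Store.mk.injEq, and_true]
  funext b j
  by_cases hb : b = a
  · subst hb
    by_cases hj : j = base + i
    · subst hj
      simp [Slice.write, Slice.rank]
    · simp only [Function.update_self, Function.update_of_ne hj, Slice.write, Slice.rank]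
      refine if_congr ?_ rfl rfl
      simp only [true_and]
      omega
  · simp [Slice.write, hb]

theorem Slice.rank_pos {s : Slice} {i : ℕ} (hi : i < s.len) : s.rank (s.pos i) = i := by
  unfold Slice.rank Slice.pos
  split_ifs <;> omega

theorem Slice.pos_mem {s : Slice} {i : ℕ} (hi : i < s.len) :
    s.start ≤ s.pos i ∧ s.pos i < s.start + s.len := by
  unfold Slice.pos
  split_ifs <;> omega

theorem Slice.Disjoint.symm {s t : Slice} (h : s.Disjoint t) : t.Disjoint s := by
  rcases h with h | h | h
  · exact .inl h.symm
  · exact .inr (.inr h)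
  · exact .inr (.inl h)

theorem Slice.write_pos (s : Slice) (v : ℕ → Cell K) (μ : Arr → ℕ → Cell K) {i : ℕ}
    (hi : i < s.len) : s.write v μ s.arr (s.pos i) = v i := by
  rw [Slice.write, if_pos ⟨rfl, Slice.pos_mem hi⟩, Slice.rank_pos hi]

theorem Slice.write_pos_of_disjoint {s t : Slice} (h : s.Disjoint t) (v : ℕ → Cell K)
    (μ : Arr → ℕ → Cell K) {i : ℕ} (hi : i < t.len) :
    s.write v μ t.arr (t.pos i) = μ t.arr (t.pos i) := by
  have := Slice.pos_mem hi
  rw [Slice.write, if_neg]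
  rintro ⟨h1, h2⟩
  rcases h with h | h
  · exact h h1.symm
  · omega

theorem write_mk_add {a : Arr} {base N i : ℕ} (v : ℕ → Cell K) (μ : Arr → ℕ → Cell K)
    (hi : i < N) : (Slice.mk a base N false).write v μ a (base + i) = v i := by
  rw [Slice.write, if_pos ⟨rfl, Nat.le_add_right _ _, by simpa using hi⟩]
  simp [Slice.rank]

theorem write_mk_of_notMem {a b : Arr} {base N j : ℕ} (v : ℕ → Cell K) (μ : Arr → ℕ → Cell K)
    (h : b = a → j < base ∨ base + N ≤ j) :
    (Slice.mk a base N false).write v μ b j = μ b j := by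
  rw [Slice.write, if_neg]
  rintro ⟨h1, h2, h3⟩
  have := h h1
  simp only at *
  omega

end slices

/-! ### Total correctness -/

/-- The program `c` started in `σ` halts, and the final store and the number of operations
satisfy `Post`. -/
def WP {K : Type*} [CommRing K] (B : ℕ) (len : Arr → ℕ) (c : Cmd) (σ : Store K)
    (Post : Store K → ℕ → Prop) : Prop :=
  ∃ τ t, Exec B len c σ τ t ∧ Post τ t

section rules

variable {K : Type*} [CommRing K] {B : ℕ} {len : Arr → ℕ} {σ : Store K}

theorem WP.mono {c : Cmd} {P P' : Store K → ℕ → Prop} (h : WP B len c σ P)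
    (hP : ∀ τ t, P τ t → P' τ t) : WP B len c σ P' := by
  obtain ⟨τ, t, h1, h2⟩ := h
  exact ⟨τ, t, h1, hP _ _ h2⟩

theorem WP.seq {c d : Cmd} {P P' : Store K → ℕ → Prop} (h : WP B len c σ P)
    (hd : ∀ τ s, P τ s → WP B len d τ fun υ t => P' υ (s + t)) : WP B len (.seq c d) σ P' := by
  obtain ⟨τ, s, h1, h2⟩ := h
  obtain ⟨υ, t, h3, h4⟩ := hd _ _ h2
  exact ⟨υ, s + t, .seq h1 h3, h4⟩

theorem WP.assign_seq {r v : ℕ} {e : IExp} {d : Cmd} {P : Store K → ℕ → Prop}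
    (he : e.eval σ.idx = v) (hv : v ≤ B) (h : WP B len d (σ.setIdx r v) P) :
    WP B len (.seq (.assign r e) d) σ P := by
  subst he
  obtain ⟨τ, t, h1, h2⟩ := h
  exact ⟨τ, 0 + t, .seq (.assign hv) h1, by simpa using h2⟩

/-- In this rule and the next two, addresses and contents are variables tied by equations, so that a
proof can supply closed forms in place of unevaluated index expressions. -/
theorem exec_zero {a : Arr} {e : IExp} {x : ℕ} (ha : a.Writable) (he : e.eval σ.idx = x)
    (hx : x < len a) : Exec B len (.zero a e) σ (σ.setCell a x (.elt 0)) 0 := by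
  subst he
  exact .zero ha hx

theorem exec_copy {a b : Arr} {e f : IExp} {x y : ℕ} {u : Cell K} (ha : a.Writable)
    (he : e.eval σ.idx = x) (hx : x < len a) (hf : f.eval σ.idx = y) (hy : y < len b)
    (hu : σ.mem b y = u) : Exec B len (.copy a e b f) σ (σ.setCell a x u) 0 := by
  subst he hf hu
  exact .copy ha hx hy

theorem exec_arith {o : Op} {a b b' : Arr} {e f f' : IExp} {x y y' : ℕ} {u v : K}
    (ha : a.Writable) (he : e.eval σ.idx = x) (hx : x < len a) (hf : f.eval σ.idx = y)
    (hy : y < len b) (hf' : f'.eval σ.idx = y') (hy' : y' < len b')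
    (hu : σ.mem b y = .elt u) (hv : σ.mem b' y' = .elt v) :
    Exec B len (.arith o a e b f b' f') σ (σ.setCell a x (.elt (o.eval u v))) 1 := by
  subst he hf hf'
  exact .arith ha hx hy hy' hu hv

/-- Counting loops, with the invariant `I`. -/
theorem WP.for' {reg N w : ℕ} {bound : IExp} {c : Cmd} (I : ℕ → Store K → Prop) (hN : N ≤ B)
    (h0 : I 0 (σ.setIdx reg 0))
    (hb : ∀ i τ, I i τ → bound.eval τ.idx = N ∧ τ.idx reg = i)
    (hstep : ∀ i τ, i < N → I i τ → WP B len c τ fun υ t =>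
      I (i + 1) (υ.setIdx reg (i + 1)) ∧ υ.idx reg = i ∧ t ≤ w) :
    WP B len (Alg.for' reg bound c) σ fun τ t => I N τ ∧ t ≤ N * w := by
  -- Induction on the number `q` of remaining turns; the loop condition is the truncated difference
  -- `N - i`, which vanishes exactly at the end.
  have main : ∀ q i τ, i + q = N → I i τ → WP B len
      (.loop (.sub bound (.reg reg)) (.seq c (.assign reg (.add (.reg reg) (.const 1))))) τ
      fun υ t => I N υ ∧ t ≤ q * w := by
    intro q
    induction q with
    | zero =>
      intro i τ hi hI
      obtain ⟨h1, h2⟩ := hb i τ hI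
      obtain rfl : i = N := by simpa using hi
      exact ⟨τ, 0, .loop_done (by simp [IExp.eval, h1, h2]), hI, by simp⟩
    | succ q ih =>
      intro i τ hi hI
      obtain ⟨h1, h2⟩ := hb i τ hI
      obtain ⟨υ, t, h3, h4, h5, h6⟩ := hstep i τ (by omega) hI
      obtain ⟨υ', t', h7, h8, h9⟩ := ih (i + 1) _ (by omega) h4
      have he : (IExp.add (.reg reg) (.const 1)).eval υ.idx = i + 1 := by simp [IExp.eval, h5]
      refine ⟨υ', (t + 0) + t', .loop_step (by simp only [IExp.eval, h1, h2]; omega)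
        (.seq h3 (.assign (by rw [he]; omega))) (by rw [he]; exact h7), h8, ?_⟩
      rw [add_mul]
      omega
  exact WP.assign_seq rfl (Nat.zero_le _) (main N 0 _ (by simp) h0)

/-- Counting loops that write one register of a segment at each turn. -/
theorem WP.fill {reg N w base : ℕ} {bound : IExp} {c : Cmd} {a : Arr} (v : ℕ → Cell K)
    (hN : N ≤ B) (hb : ∀ i, bound.eval (Function.update σ.idx reg i) = N)
    (hstep : ∀ i < N, ∃ t ≤ w, ∀ τ : Store K, τ =
      ⟨(Slice.mk a base i false).write v σ.mem, Function.update σ.idx reg i⟩ →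
        Exec B len c τ (τ.setCell a (base + i) (v i)) t) :
    WP B len (Alg.for' reg bound c) σ fun τ t =>
      τ = ⟨(Slice.mk a base N false).write v σ.mem, Function.update σ.idx reg N⟩ ∧
        t ≤ N * w := by
  refine WP.for' (fun i τ => τ =
    ⟨(Slice.mk a base i false).write v σ.mem, Function.update σ.idx reg i⟩) hN ?_ ?_ ?_
  · simp only [Store.setIdx, Store.mk.injEq, and_true]
    funext b j
    rw [Slice.write, if_neg (by simp)]
  · rintro i τ rfl
    exact ⟨hb i, by simp⟩
  · rintro i τ hi hτ
    obtain ⟨t, ht, h⟩ := hstep i hi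
    refine ⟨_, t, h τ hτ, ?_, ?_, ht⟩
    · rw [hτ, setCell_write]
      simp [Store.setIdx]
    · rw [hτ]
      simp [Store.setCell]

/-- Calls of a routine. The registers outside the output, the work space and the extra registers
of the routine are not modified. -/
theorem WP.run {p : Routine} {m : IExp} {x y z w : View} {sx sy sz sw : Slice} {N : ℕ} {T : ℝ}
    {Φ : (ℕ → Cell K) → Prop}
    (hx : x.eval σ.idx = sx) (hy : y.eval σ.idx = sy) (hz : z.eval σ.idx = sz)
    (hw : w.eval σ.idx = sw) (hm : m.eval σ.idx = N) (hN : N ≤ B)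
    (bx : sx.start + sx.len ≤ len sx.arr) (bY : sy.start + sy.len ≤ len sy.arr)
    (bz : sz.start + sz.len ≤ len sz.arr) (bw : sw.start + sw.len ≤ len sw.arr)
    (be : p.extra ≤ len .extra) (wz : sz.arr.Writable) (ww : sw.arr.Writable)
    (zx : sz.Disjoint sx) (zy : sz.Disjoint sy) (zw : sz.Disjoint sw)
    (ze : sz.Disjoint ⟨.extra, 0, p.extra, false⟩)
    (wx : sw.Disjoint sx) (wy : sw.Disjoint sy)
    (we : sw.Disjoint ⟨.extra, 0, p.extra, false⟩)
    (xe : sx.Disjoint ⟨.extra, 0, p.extra, false⟩)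
    (ye : sy.Disjoint ⟨.extra, 0, p.extra, false⟩)
    (hrun : ∀ μ : Arr → ℕ → Cell K, (∀ i, μ .in₁ i = σ.mem sx.arr (sx.pos i)) →
      (∀ i, μ .in₂ i = σ.mem sy.arr (sy.pos i)) →
      ∃ (τ : Store K) (t : ℕ),
        Exec B (shape sx.len sy.len sz.len sw.len p.extra) p.code ⟨μ, initIdx N⟩ τ t ∧
        Φ (τ.mem .out) ∧ (t : ℝ) ≤ T) :
    WP B len (Alg.run p m x y z w) σ fun υ t => υ.idx = σ.idx ∧
      (∃ v, Φ v ∧ ∀ i < sz.len, υ.mem sz.arr (sz.pos i) = v i) ∧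
      (∀ a j, ¬(a = sz.arr ∧ sz.start ≤ j ∧ j < sz.start + sz.len) →
        ¬(a = sw.arr ∧ sw.start ≤ j ∧ j < sw.start + sw.len) → ¬(a = .extra ∧ j < p.extra) →
        υ.mem a j = σ.mem a j) ∧ (t : ℝ) ≤ T := by
  subst hx hy hz hw hm
  set e : View := Alg.fwd .extra (.const 0) (.const p.extra)
  set s : Arr → Slice := fun a => (Alg.args x y z w e a).eval σ.idx with hs
  obtain ⟨τ, t, h1, h2, h3⟩ := hrun (fun a i => σ.mem (s a).arr ((s a).pos i))
    (fun _ => rfl) (fun _ => rfl)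
  have hlen : (fun a => (s a).len) = shape (x.eval σ.idx).len (y.eval σ.idx).len
      (z.eval σ.idx).len (w.eval σ.idx).len p.extra := by
    funext a
    cases a <;> rfl
  rw [← hlen] at h1
  refine ⟨_, t, .call (s := s) (fun _ => rfl) ?_ ?_ ?_ hN h1, rfl, ⟨_, h2, ?_⟩, ?_, h3⟩
  · rintro (_ | _)
    · exact bx
    · exact bY
    · exact bz
    · exact bw
    · exact (Nat.zero_add _).trans_le be
  · rintro (_ | _) h
    · exact h.elim
    · exact h.elim
    · exact wz
    · exact ww
    · exact trivial
  · rintro (_ | _) (_ | _) h hab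
    all_goals first
      | exact h.elim
      | exact absurd rfl hab
      | assumption
      | exact Slice.Disjoint.symm (by assumption)
  · intro i hi
    -- The output is written back first, so the later write-backs of the work space and of the extra
    -- registers have to miss it.
    show Slice.write ⟨.extra, 0, p.extra, false⟩ _ _ _ _ = _
    rw [Slice.write_pos_of_disjoint ze.symm _ _ hi, Slice.write_pos_of_disjoint (s := s .work)
        zw.symm _ _ hi]
    exact Slice.write_pos (s .out) _ _ hi
  · intro a j hz hw h
    show Slice.write _ _ _ a j = _
    rw [Slice.write, if_neg, Slice.write, if_neg, Slice.write, if_neg]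
    · exact hz
    · exact hw
    · rintro ⟨h4, -, h5⟩
      exact h ⟨h4, (h5 : j < 0 + p.extra).trans_eq (Nat.zero_add _)⟩

end rules

/-! ### The middle product of the main loop -/

/-- `p` computes middle products in size `(2m - 1, m)` with word bound `B`. -/
def MiddleProductAt (K : Type*) [CommRing K] (p : Routine) (T : ℝ) (c : ℝ) (B m : ℕ) : Prop :=
  ∀ (μ : Arr → ℕ → Cell K) (P R : K[X]), Holds μ .in₁ (2 * m - 1) P → Holds μ .in₂ m R →
    ∃ (τ : Store K) (t : ℕ),
      Exec B (shape (2 * m - 1) m m ⌊c * (m : ℝ)⌋₊ p.extra) p.code ⟨μ, initIdx m⟩ τ t ∧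
      Holds τ.mem .out m (middleProduct m m P R) ∧ (t : ℝ) ≤ T

/-- `p` computes short products in size `m` with word bound `B`. -/
def ShortProductAt (K : Type*) [CommRing K] (p : Routine) (T : ℝ) (c : ℝ) (B m : ℕ) : Prop :=
  ∀ (μ : Arr → ℕ → Cell K) (P R : K[X]), Holds μ .in₁ m P → Holds μ .in₂ m R →
    ∃ (τ : Store K) (t : ℕ),
      Exec B (shape m m m ⌊c * (m : ℝ)⌋₊ p.extra) p.code ⟨μ, initIdx m⟩ τ t ∧
      Holds τ.mem .out m (shortProduct m P R) ∧ (t : ℝ) ≤ T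

/-- `p` computes inverses of power series at precision `m` with word bound `B`. -/
def InversionAt (K : Type*) [CommRing K] (p : Routine) (T : ℝ) (c : ℝ) (B m : ℕ) : Prop :=
  ∀ (μ : Arr → ℕ → Cell K) (P : K[X]), Holds μ .in₁ m P → IsUnit (P.coeff 0) →
    ∃ (τ : Store K) (t : ℕ) (R : K[X]),
      Exec B (shape m 0 m ⌊c * (m : ℝ)⌋₊ p.extra) p.code ⟨μ, initIdx m⟩ τ t ∧
      Holds τ.mem .out m R ∧ X ^ m ∣ P * R - 1 ∧ (t : ℝ) ≤ T

section

variable {K : Type*} [CommRing K] {B : ℕ} {len : Arr → ℕ}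

theorem holds_chunk {μ : Arr → ℕ → Cell K} {a : Arr} {m : ℕ} (f : ℕ → K) (x : ℕ)
    (h : ∀ i < m, μ a i = .elt (f (x + i))) : Holds μ a m (chunk f x (x + m)) := by
  refine ⟨degree_chunk_lt _ _ _ _ (by omega), fun i hi => ?_⟩
  rw [h i hi, coeff_chunk, if_pos (by omega)]

/-- A middle product in size `(2l - 1, l)` of the main loop. -/
theorem WP.middleProduct {mp : Routine} {cm T : ℝ} {n k l x y z : ℕ} {xe ye ze : IExp}
    {σ : Store K} (hk : σ.idx 1 = k) (hl : σ.idx 2 = l) (l0 : 0 < l) (hlB : l ≤ B)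
    (h₂ : len .in₂ = n) (ho : len .out = n) (he : mp.extra ≤ len .extra)
    (hmp : MiddleProductAt K mp T cm B l)
    (hx : xe.eval σ.idx = x) (hy : ye.eval σ.idx = y) (hz : ze.eval σ.idx = z)
    (bx : x + (2 * l - 1) ≤ n) (bY : y + l ≤ n) (bz : z + l ≤ n)
    (bw : k + l + ⌊cm * (l : ℝ)⌋₊ ≤ n)
    (zy : z + l ≤ y ∨ y + l ≤ z) (zw : z + l ≤ k + l ∨ k + l + ⌊cm * (l : ℝ)⌋₊ ≤ z)
    (yw : y ≤ k) {G q : ℕ → K}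
    (hG : ∀ i < n, σ.mem .in₂ i = .elt (G i)) (hq : ∀ i < l, σ.mem .out (y + i) = .elt (q i)) :
    WP B len (Alg.run mp Alg.ℓ
      (Alg.fwd .in₂ xe (.sub (.mul (.const 2) Alg.ℓ) (.const 1))) (Alg.fwd .out ye Alg.ℓ)
      (Alg.fwd .out ze Alg.ℓ) (Alg.fwd .out (.add Alg.k Alg.ℓ) (.floorMul cm Alg.ℓ))) σ
      fun τ t => τ.idx = σ.idx ∧
        (∀ i < l, τ.mem .out (z + i) =
          .elt (∑ u ∈ Finset.range l, G (x + (l - 1 + i - u)) * q u)) ∧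
        (∀ a j, a ≠ .extra → (a = .out → ¬(z ≤ j ∧ j < z + l)) →
          (a = .out → ¬(k + l ≤ j ∧ j < k + l + ⌊cm * (l : ℝ)⌋₊)) →
          τ.mem a j = σ.mem a j) ∧ (t : ℝ) ≤ T := by
  have key := WP.run (B := B) (len := len) (σ := σ) (p := mp) (m := Alg.ℓ) (N := l) (T := T)
    (x := Alg.fwd .in₂ xe (.sub (.mul (.const 2) Alg.ℓ) (.const 1)))
    (y := Alg.fwd .out ye Alg.ℓ) (z := Alg.fwd .out ze Alg.ℓ)
    (w := Alg.fwd .out (.add Alg.k Alg.ℓ) (.floorMul cm Alg.ℓ))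
    (sx := ⟨.in₂, x, 2 * l - 1, false⟩) (sy := ⟨.out, y, l, false⟩) (sz := ⟨.out, z, l, false⟩)
    (sw := ⟨.out, k + l, ⌊cm * (l : ℝ)⌋₊, false⟩)
    (Φ := fun v => ∀ i < l, v i = .elt (∑ u ∈ Finset.range l, G (x + (l - 1 + i - u)) * q u))
    (by simp [View.eval, Alg.fwd, IExp.eval, Alg.ℓ, hx, hl])
    (by simp [View.eval, Alg.fwd, IExp.eval, Alg.ℓ, hy, hl])
    (by simp [View.eval, Alg.fwd, IExp.eval, Alg.ℓ, hz, hl])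
    (by simp [View.eval, Alg.fwd, IExp.eval, Alg.ℓ, Alg.k, hk, hl])
    (by simp [IExp.eval, Alg.ℓ, hl]) hlB
    (by simp only; omega) (by simp only; omega) (by simp only; omega) (by simp only; omega) he
    trivial trivial (.inl nofun) (.inr zy) (.inr zw) (.inl nofun)
    (.inl nofun) (.inr (.inr (by simp only; omega))) (.inl nofun) (.inl nofun) (.inl nofun) ?_
  · refine key.mono fun τ t h => ⟨h.1, ?_, fun a j ha hz hw => h.2.2.1 a j ?_ ?_ ?_, h.2.2.2⟩
    · obtain ⟨v, h1, h2⟩ := h.2.1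
      intro i hi
      rw [← h1 i hi, ← h2 i hi]
      rfl
    · exact fun h => hz h.1 h.2
    · exact fun h => hw h.1 h.2
    · exact fun h => ha h.1
  · intro μ h1 h2
    have hP : Holds μ .in₁ (2 * l - 1) (chunk G x (x + (2 * l - 1))) := by
      refine holds_chunk _ _ fun i hi => ?_
      rw [h1, ← hG _ (by omega)]
      rfl
    have hR : Holds μ .in₂ l (chunk q 0 (0 + l)) := by
      refine holds_chunk _ _ fun i hi => ?_
      rw [h2, Nat.zero_add, ← hq _ hi]
      rfl
    obtain ⟨τ, t, h3, ⟨-, h4⟩, h5⟩ := hmp μ _ _ hP hR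
    refine ⟨τ, t, h3, fun i hi => ?_, h5⟩
    rw [h4 i hi, coeff_middleProduct _ hR.1 hi]
    congr 1
    refine Finset.sum_congr rfl fun u hu => ?_
    have hu := Finset.mem_range.1 hu
    rw [coeff_chunk, coeff_chunk, if_pos (by omega), if_pos (by omega), Nat.zero_add]

/-- The middle products whose results are added up. -/
theorem WP.middleProduct_blocks {mp : Routine} {cm T : ℝ} {n k l : ℕ} (l0 : 0 < l)
    (hnB : n ≤ B) (h₂ : len .in₂ = n) (ho : len .out = n) (he : mp.extra ≤ len .extra)
    (hmp : MiddleProductAt K mp T cm B l) (hs : k + 3 * l + ⌊cm * (l : ℝ)⌋₊ ≤ n)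
    {G Q : ℕ → K} (q : ℕ) : ∀ (j : ℕ) (S : ℕ → K) (σ : Store K),
    j + q * l = k → σ.idx 0 = n → σ.idx 1 = k → σ.idx 2 = l → σ.idx 4 = j →
    (∀ i < n, σ.mem .in₂ i = .elt (G i)) → (∀ i < k, σ.mem .out i = .elt (Q i)) →
    (∀ i < l, σ.mem .out (n - 2 * l + i) = .elt (S i)) →
    WP B len (.loop (.sub Alg.k Alg.j) <|
      .seq (Alg.run mp Alg.ℓ
        (Alg.fwd .in₂ (.sub (.add Alg.k (.const 1)) (.add Alg.j Alg.ℓ))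
          (.sub (.mul (.const 2) Alg.ℓ) (.const 1)))
        (Alg.fwd .out Alg.j Alg.ℓ) (Alg.fwd .out Alg.k Alg.ℓ)
        (Alg.fwd .out (.add Alg.k Alg.ℓ) (.floorMul cm Alg.ℓ))) <|
      .seq (Alg.for' 3 Alg.ℓ (.arith .add .out (.add Alg.d Alg.i) .out (.add Alg.d Alg.i)
        .out (.add Alg.k Alg.i)))
      (.assign 4 (.add Alg.j Alg.ℓ))) σ
      fun τ t => (τ.idx 0 = n ∧ τ.idx 1 = k ∧ τ.idx 2 = l) ∧
        (∀ i < l, τ.mem .out (n - 2 * l + i) =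
          .elt (S i + ∑ u ∈ Finset.Ico j k, G (k + i - u) * Q u)) ∧
        (∀ a j, a ≠ .extra → (a = .out → j < k ∨ n - l ≤ j) → τ.mem a j = σ.mem a j) ∧
        (t : ℝ) ≤ q * (T + l) := by
  induction q with
  | zero =>
    intro j S σ hj h0 h1 hl h4 hG hQ hS
    obtain rfl : j = k := by simpa using hj
    exact ⟨σ, 0, .loop_done (by simp [IExp.eval, Alg.k, Alg.j, h1, h4]), ⟨h0, h1, hl⟩,
      by simpa using hS, fun _ _ _ _ => rfl, by simp⟩
  | succ q ih =>
    intro j S σ hj h0 h1 hl h4 hG hQ hS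
    have hjk : j + l ≤ k := by rw [add_mul] at hj; omega
    -- The block `Q_[j..j+l[` meets the coefficients of `G` of index `k + i - (j + u)` with `i, u <
    -- l`: these are `2 * l - 1` consecutive ones, starting at `k + 1 - (j + l)`.
    have hstep := WP.middleProduct (B := B) (len := len) (σ := σ) (x := k + 1 - (j + l))
      (y := j) (z := k) (xe := .sub (.add Alg.k (.const 1)) (.add Alg.j Alg.ℓ)) (ye := Alg.j)
      (ze := Alg.k) (q := fun u => Q (j + u)) h1 hl l0 (by omega) h₂ ho he hmp
      (by simp [IExp.eval, Alg.k, Alg.j, Alg.ℓ, h1, hl, h4])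
      (by simp [IExp.eval, Alg.j, h4]) (by simp [IExp.eval, Alg.k, h1]) (by omega) (by omega)
      (by omega) (by omega) (by omega) (.inl le_rfl) (by omega) hG
      (fun i hi => hQ _ (by omega))
    obtain ⟨τ, t, e1, i1, m1, f1, t1⟩ := hstep
    obtain ⟨υ, t', e2, hυ, t2⟩ := WP.fill (B := B) (len := len) (σ := τ) (reg := 3) (w := 1)
      (base := n - 2 * l) (bound := Alg.ℓ) (a := .out)
      (c := .arith .add .out (.add Alg.d Alg.i) .out (.add Alg.d Alg.i) .out (.add Alg.k Alg.i))
      (fun i => .elt (S i + ∑ u ∈ Finset.range l, G (k + 1 - (j + l) + (l - 1 + i - u)) *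
        Q (j + u))) (N := l) (by omega)
      (by simp [IExp.eval, Alg.ℓ, i1, hl]) (by
        intro i hi
        refine ⟨1, le_rfl, ?_⟩
        rintro υ rfl
        refine exec_arith (o := .add) (x := n - 2 * l + i) (y := n - 2 * l + i) (y' := k + i)
          trivial ?_ ?_ ?_ ?_ ?_ ?_ ?_ ?_
        · simp [IExp.eval, Alg.d, Alg.n, Alg.ℓ, Alg.i, i1, h0, hl]
        · omega
        · simp [IExp.eval, Alg.d, Alg.n, Alg.ℓ, Alg.i, i1, h0, hl]
        · omega
        · simp [IExp.eval, Alg.k, Alg.i, i1, h1]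
        · omega
        · simp only
          rw [write_mk_of_notMem _ _ fun _ => by omega, f1 .out _ nofun (by omega) (by omega),
            hS _ hi]
        · simp only
          rw [write_mk_of_notMem _ _ fun _ => by omega, m1 _ hi])
    have f2 : ∀ a i, a ≠ .extra → (a = .out → i < k ∨ n - l ≤ i) →
        υ.mem a i = σ.mem a i := by
      intro a i ha hi
      rw [hυ]
      simp only
      rw [write_mk_of_notMem, f1 _ _ ha]
      all_goals
        intro h
        have := hi h
        omega
    have hi2 : υ.idx = Function.update σ.idx 3 l := by rw [hυ, ← i1]
    -- The induction hypothesis is applied with the partial sum enlarged by the block just treated.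
    obtain ⟨ω, t'', e3, i3, m3, f3, t3⟩ := ih (j + l)
      (fun i => S i + ∑ u ∈ Finset.range l, G (k + 1 - (j + l) + (l - 1 + i - u)) * Q (j + u))
      (υ.setIdx 4 (j + l)) (by rw [add_mul] at hj; omega)
      (by simp [Store.setIdx, hi2, h0]) (by simp [Store.setIdx, hi2, h1])
      (by simp [Store.setIdx, hi2, hl]) (by simp [Store.setIdx])
      (fun i hi => by rw [← hG i hi]; exact f2 _ _ nofun nofun)
      (fun i hi => by rw [← hQ i hi]; exact f2 _ _ nofun fun _ => .inl hi)
      (fun i hi => by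
        simp only [Store.setIdx, hυ]
        exact write_mk_add _ _ hi)
    have he4 : (IExp.add Alg.j Alg.ℓ).eval υ.idx = j + l := by
      simp [IExp.eval, Alg.j, Alg.ℓ, hi2, h4, hl]
    refine ⟨ω, (t + (t' + 0)) + t'', .loop_step ?_ (.seq e1 (.seq e2 (.assign ?_))) ?_, i3, ?_,
      ?_, ?_⟩
    · simp only [IExp.eval, Alg.k, Alg.j, h1, h4]
      omega
    · rw [he4]
      omega
    · rw [he4]
      exact e3
    · intro i hi
      rw [m3 i hi, add_assoc, ← Finset.sum_Ico_consecutive _ (Nat.le_add_right j l) hjk,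
        Finset.sum_Ico_eq_sum_range _ j (j + l), Nat.add_sub_cancel_left]
      congr 3
      refine Finset.sum_congr rfl fun u hu => ?_
      have hu := Finset.mem_range.1 hu
      congr 2
      omega
    · intro a i ha hi
      rw [f3 a i ha hi]
      exact f2 a i ha hi
    · have : (t' : ℝ) ≤ l := by exact_mod_cast (by simpa using t2)
      push_cast
      linarith

/-- With `r = k % l`, the prefix of length `r` of `Q` is padded to length `l`, and the rest splits
into `k / l` full blocks. This gives at most `k / l + 1` calls, and `(k / l) * l ≤ k` additions. The
space condition counts `l` registers for the padded block or an intermediate product, `l` for the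
result, `l` for the protected inverse at the end, and the work space of the routine. -/
theorem WP.unbalancedMP {mp : Routine} {cm T : ℝ} {n k l : ℕ} {σ : Store K} (l0 : 0 < l)
    (hnB : n ≤ B) (h₂ : len .in₂ = n) (ho : len .out = n) (he : mp.extra ≤ len .extra)
    (hmp : MiddleProductAt K mp T cm B l) (hT : 0 ≤ T)
    (hs : k + 3 * l + ⌊cm * (l : ℝ)⌋₊ ≤ n)
    (h0 : σ.idx 0 = n) (h1 : σ.idx 1 = k) (hl : σ.idx 2 = l) {G Q : ℕ → K}
    (hG : ∀ i < n, σ.mem .in₂ i = .elt (G i)) (hQ : ∀ i < k, σ.mem .out i = .elt (Q i)) :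
    WP B len (Alg.unbalancedMP mp cm) σ
      fun τ t => (τ.idx 0 = n ∧ τ.idx 1 = k ∧ τ.idx 2 = l) ∧
        (∀ i < l, τ.mem .out (n - 2 * l + i) =
          .elt (∑ u ∈ Finset.range k, G (k + i - u) * Q u)) ∧
        (∀ a j, a ≠ .extra → (a = .out → j < k ∨ n - l ≤ j) → τ.mem a j = σ.mem a j) ∧
        (t : ℝ) ≤ ((k / l : ℕ) + 1) * T + k := by
  have hr : k % l < l := Nat.mod_lt _ l0
  have hrk : k % l ≤ k := Nat.mod_le _ _
  have hdiv : k % l + k / l * l = k := by rw [mul_comm]; exact Nat.mod_add_div k l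
  generalize k % l = r at hr hrk hdiv
  have hmod : (IExp.mod Alg.k Alg.ℓ).eval σ.idx = r := by
    simp only [IExp.eval, Alg.k, Alg.ℓ, h1, hl]
    rw [← hdiv, Nat.add_mul_mod_self_right, Nat.mod_eq_of_lt hr]
  refine WP.assign_seq hmod (by omega) ?_
  set σ' := σ.setIdx 5 r with hσ'
  have i0 : ∀ s, s ≠ 5 → σ'.idx s = σ.idx s := fun s hs => by simp [hσ', Store.setIdx, hs]
  have i5 : σ'.idx 5 = r := by simp [hσ', Store.setIdx]
  have hm' : σ'.mem = σ.mem := rfl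
  rw [← hm'] at hG hQ
  refine WP.seq (P := fun τ t => (∀ s, s ≠ 3 → τ.idx s = σ'.idx s) ∧
    (∀ i < l, τ.mem .out (n - 2 * l + i) =
      .elt (∑ u ∈ Finset.range r, G (k + i - u) * Q u)) ∧
    (∀ a j, a ≠ .extra → (a = .out → j < k ∨ n - l ≤ j) → τ.mem a j = σ'.mem a j) ∧
    (t : ℝ) ≤ T) ?_ ?_
  · by_cases hr0 : r = 0
    · subst hr0
      obtain ⟨τ, t, e1, hτ, t1⟩ := WP.fill (B := B) (len := len) (σ := σ') (reg := 3) (w := 0)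
        (base := n - 2 * l) (bound := Alg.ℓ) (a := .out)
        (c := .zero .out (.add Alg.d Alg.i))
        (fun i => .elt 0) (N := l) (by omega)
        (by simp [IExp.eval, Alg.ℓ, i0, hl]) (by
          intro i hi
          refine ⟨0, le_rfl, ?_⟩
          rintro υ rfl
          refine exec_zero trivial ?_ ?_
          · simp [IExp.eval, Alg.d, Alg.n, Alg.ℓ, Alg.i, i0, h0, hl]
          · omega)
      refine ⟨τ, t, .cond_false (by simp [IExp.eval, Alg.r, i5]) e1, ?_, ?_, ?_, ?_⟩
      · intro s hs
        simp [hτ, hs]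
      · intro i hi
        rw [hτ, Finset.range_zero, Finset.sum_empty]
        simp only
        exact write_mk_add _ _ hi
      · intro a j ha hj
        rw [hτ]
        simp only
        exact write_mk_of_notMem _ _ fun h => by have := hj h; omega
      · have : t = 0 := by omega
        simpa [this] using hT
    -- The zeros are put in front, in the low degrees. Index `l - r + v` of the padded block then
    -- carries `Q v`, and the chunk of `G` starting at `k + 1 - r` pairs it with `G (k + i - v)`.
    · set q : ℕ → K := fun i => if i < l - r then 0 else Q (i - (l - r)) with hq
      obtain ⟨τ, t, e1, hτ, t1⟩ := WP.fill (B := B) (len := len) (σ := σ') (reg := 3) (w := 0)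
        (base := k) (bound := Alg.ℓ) (a := .out)
        (c := .cond (.sub (.sub Alg.ℓ Alg.r) Alg.i) (.zero .out (.add Alg.k Alg.i))
          (.copy .out (.add Alg.k Alg.i) .out (.sub Alg.i (.sub Alg.ℓ Alg.r))))
        (fun i => .elt (q i)) (N := l) (by omega)
        (by simp [IExp.eval, Alg.ℓ, i0, hl]) (by
          intro i hi
          refine ⟨0, le_rfl, ?_⟩
          rintro υ rfl
          by_cases hir : i < l - r
          · refine .cond_true ?_ ?_
            · simp [IExp.eval, Alg.ℓ, Alg.r, Alg.i, i0, i5, hl]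
              omega
            · simp only [hq, if_pos hir]
              refine exec_zero trivial ?_ ?_
              · simp [IExp.eval, Alg.k, Alg.i, i0, h1]
              · omega
          · refine .cond_false ?_ ?_
            · simp [IExp.eval, Alg.ℓ, Alg.r, Alg.i, i0, i5, hl]
              omega
            · simp only [hq, if_neg hir]
              refine exec_copy (y := i - (l - r)) trivial ?_ ?_ ?_ ?_ ?_
              · simp [IExp.eval, Alg.k, Alg.i, i0, h1]
              · omega
              · simp [IExp.eval, Alg.ℓ, Alg.r, Alg.i, i0, i5, hl]
              · omega
              · simp only
                rw [write_mk_of_notMem _ _ fun _ => by omega, hQ _ (by omega)])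
      have i1 : τ.idx = Function.update σ'.idx 3 l := by rw [hτ]
      obtain ⟨υ, t', e2, i2, m2, f2, t2⟩ := WP.middleProduct (B := B) (len := len) (σ := τ)
        (x := k + 1 - r)
        (y := k) (z := n - 2 * l) (xe := .sub (.add Alg.k (.const 1)) Alg.r) (ye := Alg.k)
        (ze := Alg.d) (q := q) (G := G) (by simp [i1, i0, h1]) (by simp [i1, i0, hl]) l0
        (by omega) h₂ ho he hmp
        (by simp [IExp.eval, Alg.k, Alg.r, i1, i0, i5, h1])
        (by simp [IExp.eval, Alg.k, i1, i0, h1])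
        (by simp [IExp.eval, Alg.d, Alg.n, Alg.ℓ, i1, i0, h0, hl]) (by omega) (by omega)
        (by omega) (by omega) (by omega) (by omega) le_rfl
        (fun i hi => by rw [← hG i hi, hτ]; simp [Slice.write])
        (fun i hi => by
          rw [hτ]
          simp only
          exact write_mk_add _ _ hi)
      refine ⟨υ, t + t', .cond_true (by simpa [IExp.eval, Alg.r, i5] using hr0) (.seq e1 e2),
        ?_, ?_, ?_, ?_⟩
      · intro s hs
        simp [i2, i1, hs]
      · intro i hi
        rw [m2 i hi]
        -- The first `l - r` terms vanish by the padding; the others are the wanted sum over `r`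
        -- indices.
        have hl' : l = (l - r) + r := by omega
        conv_lhs => rw [hl', Finset.sum_range_add]
        rw [Finset.sum_eq_zero, zero_add]
        · congr 1
          refine Finset.sum_congr rfl fun u hu => ?_
          have hu := Finset.mem_range.1 hu
          simp only [hq]
          rw [if_neg (by omega)]
          congr 2 <;> omega
        · intro u hu
          have hu := Finset.mem_range.1 hu
          simp only [hq]
          rw [if_pos (by omega), mul_zero]
      · intro a j ha hj
        rw [f2 a j ha, hτ]
        · simp only
          exact write_mk_of_notMem _ _ fun h => by have := hj h; omega
        · intro h
          have := hj h
          omega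
        · intro h
          have := hj h
          omega
      · have : t = 0 := by omega
        simpa [this] using t2
  · rintro τ s ⟨i1, m1, f1, t1⟩
    refine WP.assign_seq (v := r) (by simp [IExp.eval, Alg.r, i1, i5]) (by omega) ?_
    refine (WP.middleProduct_blocks (G := G) (Q := Q) l0 hnB h₂ ho he hmp hs (k / l) r
      (fun i => ∑ u ∈ Finset.range r, G (k + i - u) * Q u) (τ.setIdx 4 r) hdiv
      ?_ ?_ ?_ ?_ ?_ ?_ m1).mono ?_
    · simp [Store.setIdx, i1, i0, h0]
    · simp [Store.setIdx, i1, i0, h1]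
    · simp [Store.setIdx, i1, i0, hl]
    · simp [Store.setIdx]
    · exact fun i hi => by rw [← hG i hi]; exact f1 _ _ nofun nofun
    · exact fun i hi => by rw [← hQ i hi]; exact f1 _ _ nofun fun _ => .inl hi
    · rintro υ t ⟨i2, m2, f2, t2⟩
      refine ⟨i2, ?_, ?_, ?_⟩
      · intro i hi
        rw [m2 i hi, Finset.sum_range_add_sum_Ico _ hrk]
      · intro a j ha hj
        rw [f2 a j ha hj]
        exact f1 a j ha hj
      · have : ((k / l : ℕ) : ℝ) * l ≤ k := by exact_mod_cast (by omega)
        push_cast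
        linarith

end

/-! ### One step of the iteration on polynomials -/

theorem coe_X_pow_dvd_iff {K : Type*} [CommRing K] {m : ℕ} {P : K[X]} :
    (PowerSeries.X : PowerSeries K) ^ m ∣ (P : PowerSeries K) ↔ X ^ m ∣ P := by
  simp only [PowerSeries.X_pow_dvd_iff, Polynomial.X_pow_dvd_iff, coeff_coe]

/-- The quotient at precision `k + l` from the quotient `Q` at precision `k` and the inverse `R`
at precision `l`. -/
theorem exists_quotient_add {K : Type*} [CommRing K] {F G Q R : K[X]} {k l : ℕ}
    (hQ : Q.degree < (k : WithBot ℕ)) (hF : X ^ k ∣ F - G * Q) (hR : X ^ l ∣ 1 - G * R) :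
    ∃ D Q' : K[X], (∀ t < l, D.coeff t = F.coeff (k + t) -
        ∑ u ∈ Finset.range k, G.coeff (k + t - u) * Q.coeff u) ∧
      Q'.degree < ((k + l : ℕ) : WithBot ℕ) ∧ (∀ i < k, Q'.coeff i = Q.coeff i) ∧
      (∀ t < l, Q'.coeff (k + t) = (D * R).coeff t) ∧ X ^ (k + l) ∣ F - G * Q' := by
  have key := karpMarkstein (F : PowerSeries K) (G : PowerSeries K) k l Q R hQ
    (by rw [← Polynomial.coe_mul, ← Polynomial.coe_sub, coe_X_pow_dvd_iff]; exact hF)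
    (by rw [← Polynomial.coe_mul, ← Polynomial.coe_one, ← Polynomial.coe_sub,
      coe_X_pow_dvd_iff]; exact hR)
  rw [← Polynomial.coe_mul, ← Polynomial.coe_sub, coe_X_pow_dvd_iff] at key
  refine ⟨chunk (fun i => PowerSeries.coeff i (F : PowerSeries K)) k (k + l) - middleProduct l k
    (chunk (fun i => PowerSeries.coeff i (G : PowerSeries K)) 1 (k + l)) Q, _, ?_, ?_, ?_, ?_, key⟩
  · intro t ht
    rw [coeff_sub, coeff_chunk, if_pos (by omega), coeff_middleProduct_chunk _ hQ ht]
    simp only [coeff_coe]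
  · rw [degree_lt_iff_coeff_zero] at hQ ⊢
    intro i hi
    rw [coeff_add, hQ i (by omega), coeff_X_pow_mul', if_pos (by omega), zero_add]
    exact (degree_lt_iff_coeff_zero _ _).1 (degree_chunk_lt _ _ _ _ (Nat.sub_zero l).le) _
      (by omega)
  · intro i hi
    rw [coeff_add, coeff_X_pow_mul', if_neg (by omega), add_zero]
  · intro t ht
    rw [degree_lt_iff_coeff_zero] at hQ
    rw [coeff_add, hQ _ (by omega), zero_add, add_comm k t, coeff_X_pow_mul,
      coeff_shortProduct _ _ ht, mul_comm]

/-! ### Calls of the routines -/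

section

variable {K : Type*} [CommRing K] {B : ℕ} {len : Arr → ℕ}

theorem coeff_mul_congr {A A' C C' : K[X]} {m i : ℕ} (hA : ∀ i < m, A.coeff i = A'.coeff i)
    (hC : ∀ i < m, C.coeff i = C'.coeff i) (hi : i < m) :
    (A * C).coeff i = (A' * C').coeff i := by
  rw [coeff_mul, coeff_mul]
  refine Finset.sum_congr rfl fun p hp => ?_
  have := Finset.HasAntidiagonal.mem_antidiagonal.1 hp
  rw [hA _ (by omega), hC _ (by omega)]

theorem coeff_chunk_zero (A : K[X]) {m i : ℕ} (hi : i < m) :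
    (chunk A.coeff 0 (0 + m)).coeff i = A.coeff i := by
  rw [coeff_chunk, if_pos (by omega), Nat.zero_add]

/-- The routine is specified on polynomials of size `m`, while the registers hold the first `m`
coefficients of possibly longer ones. It is applied to the truncations, which have the same product
in degrees below `m`. -/
theorem ShortProductAt.exec {p : Routine} {T c : ℝ} {m : ℕ} (h : ShortProductAt K p T c B m)
    {x y : ℕ → Cell K} {A C : K[X]} (hA : ∀ i < m, x i = .elt (A.coeff i))
    (hC : ∀ i < m, y i = .elt (C.coeff i)) (μ : Arr → ℕ → Cell K)
    (h₁ : ∀ i, μ .in₁ i = x i) (h₂ : ∀ i, μ .in₂ i = y i) :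
    ∃ (τ : Store K) (t : ℕ),
      Exec B (shape m m m ⌊c * (m : ℝ)⌋₊ p.extra) p.code ⟨μ, initIdx m⟩ τ t ∧
      (∀ i < m, τ.mem .out i = .elt ((A * C).coeff i)) ∧ (t : ℝ) ≤ T := by
  obtain ⟨τ, t, h3, ⟨-, h4⟩, h5⟩ := h μ _ _
    (holds_chunk A.coeff 0 fun i hi => by rw [h₁, hA i hi, Nat.zero_add])
    (holds_chunk C.coeff 0 fun i hi => by rw [h₂, hC i hi, Nat.zero_add])
  refine ⟨τ, t, h3, fun i hi => ?_, h5⟩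
  rw [h4 i hi, coeff_shortProduct _ _ hi]
  exact congrArg _ (coeff_mul_congr (fun _ => coeff_chunk_zero A) (fun _ => coeff_chunk_zero C) hi)

theorem InversionAt.exec {p : Routine} {T c : ℝ} {m : ℕ} (h : InversionAt K p T c B m)
    (hm : 0 < m) {x : ℕ → Cell K} {G : K[X]} (hG : ∀ i < m, x i = .elt (G.coeff i))
    (hu : IsUnit (G.coeff 0)) (μ : Arr → ℕ → Cell K) (h₁ : ∀ i, μ .in₁ i = x i) :
    ∃ (τ : Store K) (t : ℕ),
      Exec B (shape m 0 m ⌊c * (m : ℝ)⌋₊ p.extra) p.code ⟨μ, initIdx m⟩ τ t ∧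
      (∃ R : K[X], X ^ m ∣ 1 - G * R ∧ ∀ i < m, τ.mem .out i = .elt (R.coeff i)) ∧
      (t : ℝ) ≤ T := by
  obtain ⟨τ, t, R, h3, ⟨-, h4⟩, h5, h6⟩ := h μ _
    (holds_chunk G.coeff 0 fun i hi => by rw [h₁, hG i hi, Nat.zero_add])
    (by rwa [coeff_chunk_zero G hm])
  refine ⟨τ, t, h3, ⟨R, ?_, h4⟩, h6⟩
  rw [Polynomial.X_pow_dvd_iff] at h5 ⊢
  intro i hi
  have h7 := h5 i hi
  rw [coeff_sub, coeff_mul_congr (fun _ => coeff_chunk_zero G) (fun _ _ => rfl) hi] at h7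
  rw [coeff_sub, ← neg_sub, h7, neg_zero]

/-! ### The algorithm -/

/-- The number of new coefficients computed when `x` coefficients are missing. -/
noncomputable def newCoeffs (c : ℝ) (x : ℕ) : ℕ := ⌊(x : ℝ) / (3 + c)⌋₊

theorem newCoeffs_mul_le {c : ℝ} (hc : 0 ≤ c) (x : ℕ) : (3 + c) * newCoeffs c x ≤ x := by
  have h : (newCoeffs c x : ℝ) ≤ x / (3 + c) := Nat.floor_le (by positivity)
  rwa [le_div_iff₀' (by positivity)] at h

theorem newCoeffs_le {c : ℝ} (hc : 0 ≤ c) (x : ℕ) : newCoeffs c x ≤ x := by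
  have h1 := newCoeffs_mul_le hc x
  have h2 : (newCoeffs c x : ℝ) ≤ x := by nlinarith
  exact_mod_cast h2

theorem newCoeffs_mono {c : ℝ} (hc : 0 ≤ c) {x y : ℕ} (h : x ≤ y) :
    newCoeffs c x ≤ newCoeffs c y := by
  unfold newCoeffs
  gcongr

/-- Turns the real inequalities that define the precisions into integer ones about the work space
`⌊c * k⌋₊` of the program. -/
theorem add_floor_mul_le {a k x : ℕ} {c : ℝ} (hc : 0 ≤ c) (h : (a + c) * (k : ℝ) ≤ x) :
    a * k + ⌊c * (k : ℝ)⌋₊ ≤ x := by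
  have h1 : (⌊c * (k : ℝ)⌋₊ : ℝ) ≤ c * k := Nat.floor_le (by positivity)
  have h2 : ((a * k + ⌊c * (k : ℝ)⌋₊ : ℕ) : ℝ) ≤ x := by
    push_cast
    linarith
  exact_mod_cast h2

/-- At the start of each iteration the quotient is known at precision `k`, and its array ends with
the first coefficients of the inverse `R`, in the reverse order. -/
structure Invariant (n : ℕ) (c : ℝ) (F G R : K[X]) (k : ℕ) (σ : Store K) : Prop where
  idx_zero : σ.idx 0 = n
  idx_one : σ.idx 1 = k
  lt : k < n
  left : ∀ i < n, σ.mem .in₁ i = .elt (F.coeff i)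
  right : ∀ i < n, σ.mem .in₂ i = .elt (G.coeff i)
  quotient : ∃ Q : K[X], Q.degree < (k : WithBot ℕ) ∧ (∀ i < k, σ.mem .out i = .elt (Q.coeff i)) ∧
    X ^ k ∣ F - G * Q
  inverse : ∀ i < newCoeffs c (n - k), σ.mem .out (n - 1 - i) = .elt (R.coeff i)

/-- The registers from `k` to `n` are shared as follows: new coefficients in `[k..k+l[`, work space
from `k + l`, residual `D` in `[n-2l..n-l[`, reversed inverse in `[n-l..n[`. Before the short
product, `[k..k+l[` serves as a buffer of the middle product. -/
theorem WP.step {mp sp : Routine} {cm cs Tm Ts : ℝ} {n k l : ℕ} {F G R : K[X]} {σ : Store K}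
    (hcm : 0 ≤ cm) (hcs : 0 ≤ cs) (hnB : n ≤ B)
    (h₁ : len .in₁ = n) (h₂ : len .in₂ = n) (ho : len .out = n)
    (hem : mp.extra ≤ len .extra) (hes : sp.extra ≤ len .extra)
    (hmp : MiddleProductAt K mp Tm cm B l) (hsp : ShortProductAt K sp Ts cs B l) (hT : 0 ≤ Tm)
    (hR : X ^ l ∣ 1 - G * R) (hinv : Invariant n (max cm cs) F G R k σ) (hi2 : σ.idx 2 = l)
    (hl : l = newCoeffs (max cm cs) (n - k)) (l0 : 0 < l) :
    WP B len (Alg.step mp sp cm cs) σ fun τ t =>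
      Invariant n (max cm cs) F G R (k + l) τ ∧
        τ.idx 2 = newCoeffs (max cm cs) (n - (k + l)) ∧
        (t : ℝ) ≤ ((k / l : ℕ) + 1) * Tm + n + Ts := by
  obtain ⟨i0, i1, hkn, hF, hG, ⟨Q, hQd, hQ, hQF⟩, hinv⟩ := hinv
  have hc : 0 ≤ max cm cs := le_max_of_le_left hcm
  have hlk : (3 + max cm cs) * (l : ℝ) ≤ (n - k : ℕ) := hl ▸ newCoeffs_mul_le hc _
  -- Both routines fit, one after the other, because `l` was chosen with the larger of the two space
  -- constants.
  have hsm : 3 * l + ⌊cm * (l : ℝ)⌋₊ ≤ n - k := by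
    refine add_floor_mul_le hcm (le_trans ?_ hlk)
    rw [Nat.cast_ofNat]
    gcongr
    exact le_max_left _ _
  have hss : 3 * l + ⌊cs * (l : ℝ)⌋₊ ≤ n - k := by
    refine add_floor_mul_le hcs (le_trans ?_ hlk)
    rw [Nat.cast_ofNat]
    gcongr
    exact le_max_right _ _
  rw [← hl] at hinv
  obtain ⟨D, Q', hD, hQd', hQ'1, hQ'2, hQF'⟩ := exists_quotient_add hQd hQF hR
  refine WP.seq (WP.unbalancedMP l0 hnB h₂ ho hem hmp hT (by omega) i0 i1 hi2 hG hQ) ?_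
  rintro τ t ⟨⟨j0, j1, j2⟩, m1, f1, t1⟩
  refine WP.seq (WP.fill (B := B) (len := len) (σ := τ) (reg := 3) (w := 1)
    (base := n - 2 * l) (bound := Alg.ℓ) (a := .out)
    (fun i => .elt (D.coeff i)) (N := l) (by omega)
    (by simp [IExp.eval, Alg.ℓ, j2]) (by
      intro i hi
      refine ⟨1, le_rfl, ?_⟩
      rintro υ rfl
      simp only [hD i hi]
      refine exec_arith (o := .sub) (x := n - 2 * l + i) (y := k + i) (y' := n - 2 * l + i)
        trivial ?_ ?_ ?_ ?_ ?_ ?_ ?_ ?_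
      · simp [IExp.eval, Alg.d, Alg.n, Alg.ℓ, Alg.i, j0, j2]
      · omega
      · simp [IExp.eval, Alg.k, Alg.i, j1]
      · omega
      · simp [IExp.eval, Alg.d, Alg.n, Alg.ℓ, Alg.i, j0, j2]
      · omega
      · simp only
        rw [write_mk_of_notMem (a := .out) (b := .in₁) _ _ nofun, f1 .in₁ _ nofun nofun, hF _ (by omega)]
      · simp only
        rw [write_mk_of_notMem _ _ fun _ => by omega, m1 _ hi])) ?_
  rintro _ t' ⟨rfl, t2⟩
  have hrun := WP.run (B := B) (len := len)
    (σ := ⟨(Slice.mk .out (n - 2 * l) l false).write (fun i => .elt (D.coeff i)) τ.mem,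
      Function.update τ.idx 3 l⟩) (p := sp) (m := Alg.ℓ) (N := l) (T := Ts)
    (x := Alg.fwd .out Alg.d Alg.ℓ) (y := Alg.bwd .out (.sub Alg.n Alg.ℓ) Alg.ℓ)
    (z := Alg.fwd .out Alg.k Alg.ℓ)
    (w := Alg.fwd .out (.add Alg.k Alg.ℓ) (.floorMul cs Alg.ℓ))
    (sx := ⟨.out, n - 2 * l, l, false⟩) (sy := ⟨.out, n - l, l, true⟩)
    (sz := ⟨.out, k, l, false⟩) (sw := ⟨.out, k + l, ⌊cs * (l : ℝ)⌋₊, false⟩)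
    (Φ := fun v => ∀ i < l, v i = .elt ((D * R).coeff i))
    (by simp [View.eval, Alg.fwd, IExp.eval, Alg.d, Alg.n, Alg.ℓ, j0, j2])
    (by simp [View.eval, Alg.bwd, IExp.eval, Alg.n, Alg.ℓ, j0, j2])
    (by simp [View.eval, Alg.fwd, IExp.eval, Alg.k, Alg.ℓ, j1, j2])
    (by simp [View.eval, Alg.fwd, IExp.eval, Alg.k, Alg.ℓ, j1, j2])
    (by simp [IExp.eval, Alg.ℓ, j2]) (by omega)
    (by simp only; omega) (by simp only; omega) (by simp only; omega) (by simp only; omega) hes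
    trivial trivial (.inr (.inl (by simp only; omega))) (.inr (.inl (by simp only; omega)))
    (.inr (.inl (by simp only; omega))) (.inl nofun)
    (.inr (.inl (by simp only; omega))) (.inr (.inl (by simp only; omega))) (.inl nofun)
    (.inl nofun) (.inl nofun)
    (hsp.exec (fun i hi => by
      simp only [Slice.pos, Bool.false_eq_true, if_false]
      exact write_mk_add _ _ hi) (fun i hi => by
      simp only [Slice.pos, if_true]
      rw [write_mk_of_notMem _ _ fun _ => by omega, f1 .out _ nofun (fun _ => by omega),
        ← hinv i hi]
      congr 1
      omega))
  refine WP.seq hrun ?_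
  rintro υ s ⟨k1, ⟨v, hv, hυ⟩, f2, t3⟩
  simp only at hυ
  simp only [Slice.pos, Bool.false_eq_true, if_false] at hυ
  simp only at k1 f2
  have k1' : ∀ s, s ≠ 3 → υ.idx s = τ.idx s := fun s hs => by simp [k1, hs]
  -- The whole iteration preserves the inputs, the known quotient and the inverse.
  have f3 : ∀ a j, a ≠ .extra → (a = .out → j < k ∨ n - l ≤ j) → υ.mem a j = σ.mem a j := by
    intro a j ha hj
    rw [f2 a j (fun h => by have := hj h.1; have := h.2; omega)
      (fun h => by have := hj h.1; have := h.2; omega) (fun h => ha h.1),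
      write_mk_of_notMem _ _ (fun h => by have := hj h; omega), f1 a j ha hj]
  refine WP.assign_seq (v := k + l)
    (by simp [IExp.eval, Alg.k, Alg.ℓ, k1', j1, j2]) (by omega) ?_
  have he : (IExp.floorDiv (.sub Alg.n Alg.k) (3 + max cm cs)).eval (υ.setIdx 1 (k + l)).idx =
      newCoeffs (max cm cs) (n - (k + l)) := by
    simp [IExp.eval, Alg.n, Alg.k, Store.setIdx, k1', j0, newCoeffs]
  -- The number of new coefficients does not increase, so the part of the inverse that the next
  -- iteration needs lies within the one preserved.
  have hmono : newCoeffs (max cm cs) (n - (k + l)) ≤ l := by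
    conv_rhs => rw [hl]
    exact newCoeffs_mono hc (by omega)
  refine ⟨_, _, .assign (by rw [he]; omega), ⟨?_, ?_, by omega, ?_, ?_, ⟨Q', hQd', ?_, hQF'⟩, ?_⟩,
    ?_, ?_⟩
  · simp [Store.setIdx, k1', j0]
  · simp [Store.setIdx]
  · exact fun i hi => by rw [← hF i hi]; exact f3 _ _ nofun nofun
  · exact fun i hi => by rw [← hG i hi]; exact f3 _ _ nofun nofun
  · intro i hi
    rcases lt_or_ge i k with h | h
    · rw [hQ'1 i h, ← hQ i h]
      exact f3 _ _ nofun fun _ => .inl h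
    · obtain ⟨t, rfl⟩ := Nat.exists_eq_add_of_le h
      rw [hQ'2 t (by omega), ← hv t (by omega)]
      exact hυ t (by omega)
  · intro i hi
    rw [← hinv i (by omega)]
    exact f3 _ _ nofun fun _ => by omega
  · rw [he]
    simp [Store.setIdx]
  · have h1 : (t' : ℝ) ≤ l := by exact_mod_cast (by simpa using t2)
    have h2 : (k + l : ℝ) ≤ n := by exact_mod_cast (by omega)
    push_cast
    linarith

/-- The number of operations of the main loop when `x` coefficients are missing. -/
noncomputable def loopCost (Tm Ts : ℕ → ℝ) (c : ℝ) (n x : ℕ) : ℝ :=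
  if h : 0 < newCoeffs c x ∧ 0 < x then
    ((((n - x) / newCoeffs c x : ℕ) + 1) * Tm (newCoeffs c x) + n + Ts (newCoeffs c x))
      + loopCost Tm Ts c n (x - newCoeffs c x)
  else 0
termination_by x
decreasing_by omega

/-- Strong induction on the number `x` of missing coefficients. The same `R` serves throughout: it
inverts `G` modulo `X ^ k₀`, and every `l` stays at most `k₀`. -/
theorem WP.mainLoop {mp sp : Routine} {cm cs : ℝ} {Tm Ts : ℕ → ℝ} {n k₀ : ℕ} {F G R : K[X]}
    (hcm : 0 ≤ cm) (hcs : 0 ≤ cs) (hnB : n ≤ B)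
    (h₁ : len .in₁ = n) (h₂ : len .in₂ = n) (ho : len .out = n)
    (hem : mp.extra ≤ len .extra) (hes : sp.extra ≤ len .extra)
    (hmp : ∀ l, 0 < l → l ≤ n → MiddleProductAt K mp (Tm l) cm B l)
    (hsp : ∀ l, 0 < l → l ≤ n → ShortProductAt K sp (Ts l) cs B l)
    (hT : ∀ l, 0 < l → 0 ≤ Tm l) (hR : X ^ k₀ ∣ 1 - G * R) (x : ℕ) : ∀ (k : ℕ) (σ : Store K),
    n - k = x → newCoeffs (max cm cs) x ≤ k₀ → Invariant n (max cm cs) F G R k σ →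
    σ.idx 2 = newCoeffs (max cm cs) x →
    WP B len (.loop Alg.ℓ (Alg.step mp sp cm cs)) σ fun τ t =>
      (∃ k', Invariant n (max cm cs) F G R k' τ ∧ newCoeffs (max cm cs) (n - k') = 0) ∧
        (t : ℝ) ≤ loopCost Tm Ts (max cm cs) n x := by
  have hc : 0 ≤ max cm cs := le_max_of_le_left hcm
  induction x using Nat.strong_induction_on with
  | _ x ih =>
    intro k σ hk hk₀ hinv hi
    have hkn := hinv.lt
    rcases Nat.eq_zero_or_pos (newCoeffs (max cm cs) x) with h | h
    · refine ⟨σ, 0, .loop_done (by rw [← h, ← hi]; rfl), ⟨k, hinv, by rw [hk, h]⟩, ?_⟩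
      rw [loopCost, dif_neg (by omega), Nat.cast_zero]
    · have hle := newCoeffs_le hc x
      obtain ⟨τ, s, e1, hinv', hi', t1⟩ := WP.step hcm hcs hnB h₁ h₂ ho hem hes
        (hmp _ h (by omega)) (hsp _ h (by omega)) (hT _ h)
        ((pow_dvd_pow X hk₀).trans hR) hinv hi (by rw [hk]) h
      have hlt : n - (k + newCoeffs (max cm cs) x) = x - newCoeffs (max cm cs) x := by omega
      rw [hlt] at hi'
      obtain ⟨υ, t, e2, h2, t2⟩ := ih _ (by omega) _ τ hlt
        ((newCoeffs_mono hc (Nat.sub_le _ _)).trans hk₀) hinv' hi'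
      refine ⟨υ, s + t, .loop_step (by show σ.idx 2 ≠ 0; omega) e1 e2, h2, ?_⟩
      rw [loopCost, dif_pos (by omega), show n - x = k by omega]
      push_cast
      linarith

/-- The number of coefficients computed by the first step. -/
noncomputable def startCoeffs (cs ci : ℝ) (n : ℕ) : ℕ := ⌊(n : ℝ) / max (ci + 1) (cs + 2)⌋₊

theorem startCoeffs_mul_le {cs ci : ℝ} (hcs : 0 ≤ cs) (n : ℕ) :
    max (ci + 1) (cs + 2) * startCoeffs cs ci n ≤ n := by
  have h0 : 0 < max (ci + 1) (cs + 2) := lt_max_of_lt_right (by positivity)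
  have h : (startCoeffs cs ci n : ℝ) ≤ n / max (ci + 1) (cs + 2) := Nat.floor_le (by positivity)
  rwa [le_div_iff₀' h0] at h

theorem startCoeffs_le {cs ci : ℝ} (hcs : 0 ≤ cs) (n : ℕ) : startCoeffs cs ci n ≤ n := by
  have h4 := startCoeffs_mul_le (ci := ci) hcs n
  have h5 : 1 ≤ max (ci + 1) (cs + 2) := le_max_of_le_right (by linarith)
  have h6 : (startCoeffs cs ci n : ℝ) ≤ n := by nlinarith
  exact_mod_cast h6

/-- The bound on `ci` makes the initial divisor at most `c + 2` with `c = max cm cs`. Hence `n < (k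
+ 1) * (c + 2)` for the initial precision `k`, and the first iteration asks for fewer than `k + 1`
coefficients of the inverse. -/
theorem newCoeffs_le_startCoeffs {cm cs ci : ℝ} (hcm : 0 ≤ cm) (hcs : 0 ≤ cs)
    (hci : ci ≤ max cm (cs + 1) / 2) (n : ℕ) :
    newCoeffs (max cm cs) (n - startCoeffs cs ci n) ≤ startCoeffs cs ci n := by
  have h0 : 0 < max (ci + 1) (cs + 2) := lt_max_of_lt_right (by positivity)
  have hc : 0 ≤ max cm cs := le_max_of_le_left hcm
  have h1 : (n : ℝ) < (startCoeffs cs ci n + 1) * max (ci + 1) (cs + 2) := by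
    rw [← div_lt_iff₀ h0]
    exact Nat.lt_floor_add_one _
  have h2 : max (ci + 1) (cs + 2) ≤ max cm cs + 2 := by
    have := le_max_left cm cs
    have := le_max_right cm cs
    refine max_le ?_ (by linarith)
    rcases max_cases cm (cs + 1) with h | h <;> linarith
  have h3 : (n : ℝ) < (startCoeffs cs ci n + 1) * (max cm cs + 2) := h1.trans_le (by gcongr)
  have hle := startCoeffs_le (ci := ci) hcs n
  refine Nat.lt_succ_iff.1 ?_
  rw [newCoeffs, Nat.floor_lt (by positivity), div_lt_iff₀ (by positivity), Nat.cast_sub hle]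
  push_cast
  nlinarith

/-- The two terms of `max (ci + 1) (cs + 2)` are the two space requirements: `k` registers for the
inverse plus its work space, then `2 * k` registers for the inverse and the quotient plus the work
space of the short product. -/
theorem WP.start {sp inv : Routine} {cm cs ci : ℝ} {Ts Ti : ℕ → ℝ} {n : ℕ} {F G : K[X]}
    {σ : Store K} (n0 : 0 < n) (hcm : 0 ≤ cm) (hcs : 0 ≤ cs) (hci0 : 0 ≤ ci)
    (hci : ci ≤ max cm (cs + 1) / 2) (hnB : n ≤ B)
    (h₁ : len .in₁ = n) (h₂ : len .in₂ = n) (ho : len .out = n)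
    (hes : sp.extra ≤ len .extra) (hei : inv.extra ≤ len .extra)
    (hsp : ∀ l, 0 < l → l ≤ n → ShortProductAt K sp (Ts l) cs B l)
    (hinv : ∀ l, 0 < l → l ≤ n → InversionAt K inv (Ti l) ci B l)
    (h0 : σ.idx 0 = n) (hF : ∀ i < n, σ.mem .in₁ i = .elt (F.coeff i))
    (hG : ∀ i < n, σ.mem .in₂ i = .elt (G.coeff i)) (hu : IsUnit (G.coeff 0)) :
    WP B len (Alg.start sp inv cs ci) σ fun τ t =>
      (∃ R : K[X], X ^ startCoeffs cs ci n ∣ 1 - G * R ∧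
        Invariant n (max cm cs) F G R (startCoeffs cs ci n) τ) ∧
      (t : ℝ) ≤ if startCoeffs cs ci n = 0 then 0 else
        Ti (startCoeffs cs ci n) + Ts (startCoeffs cs ci n) := by
  have hnew := newCoeffs_le_startCoeffs hcm hcs hci n
  have hmul := startCoeffs_mul_le (ci := ci) hcs n
  have he : (IExp.floorDiv Alg.n (max (ci + 1) (cs + 2))).eval σ.idx = startCoeffs cs ci n := by
    simp [IExp.eval, Alg.n, h0, startCoeffs]
  generalize startCoeffs cs ci n = k at *
  have hki : 1 * k + ⌊ci * (k : ℝ)⌋₊ ≤ n := add_floor_mul_le hci0 (le_trans (by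
    gcongr
    rw [Nat.cast_one, add_comm]
    exact le_max_left _ _) hmul)
  have hks : 2 * k + ⌊cs * (k : ℝ)⌋₊ ≤ n := add_floor_mul_le hcs (le_trans (by
    gcongr
    rw [Nat.cast_two, add_comm]
    exact le_max_right _ _) hmul)
  refine WP.assign_seq he (by omega) ?_
  set σ' := σ.setIdx 1 k with hσ'
  have i0 : σ'.idx 0 = n := by simp [hσ', Store.setIdx, h0]
  have i1 : σ'.idx 1 = k := by simp [hσ', Store.setIdx]
  have hm' : σ'.mem = σ.mem := rfl
  rw [← hm'] at hF hG
  rcases Nat.eq_zero_or_pos k with rfl | k0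
  -- Nothing is computed: `Q = 0` and `R = 0` are valid at precision `0`, and `hnew` says that the
  -- loop needs no coefficient of the inverse.
  · refine ⟨σ', 0, .cond_false (by simp [IExp.eval, Alg.k, i1]) .skip,
      ⟨0, by simp, i0, i1, n0, hF, hG, ⟨0, by simp, by simp, by simp⟩, by omega⟩, by simp⟩
  · have hrun := WP.run (B := B) (len := len) (σ := σ') (p := inv) (m := Alg.k) (N := k)
      (T := Ti k)
      (x := Alg.fwd .in₂ (.const 0) Alg.k) (y := Alg.fwd .in₂ (.const 0) (.const 0))
      (z := Alg.bwd .out (.sub Alg.n Alg.k) Alg.k)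
      (w := Alg.fwd .out (.const 0) (.floorMul ci Alg.k))
      (sx := ⟨.in₂, 0, k, false⟩) (sy := ⟨.in₂, 0, 0, false⟩)
      (sz := ⟨.out, n - k, k, true⟩) (sw := ⟨.out, 0, ⌊ci * (k : ℝ)⌋₊, false⟩)
      (Φ := fun v => ∃ R : K[X], X ^ k ∣ 1 - G * R ∧ ∀ i < k, v i = .elt (R.coeff i))
      (by simp [View.eval, Alg.fwd, IExp.eval, Alg.k, i1])
      (by simp [View.eval, Alg.fwd, IExp.eval])
      (by simp [View.eval, Alg.bwd, IExp.eval, Alg.n, Alg.k, i0, i1])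
      (by simp [View.eval, Alg.fwd, IExp.eval, Alg.k, i1])
      (by simp [IExp.eval, Alg.k, i1]) (by omega)
      (by simp only; omega) (by simp only; omega) (by simp only; omega) (by simp only; omega) hei
      trivial trivial (.inl nofun) (.inl nofun) (.inr (.inr (by simp only; omega))) (.inl nofun)
      (.inl nofun) (.inl nofun) (.inl nofun) (.inl nofun) (.inl nofun)
      (fun μ hμ _ => (hinv k k0 (by omega)).exec k0 (fun i hi => by
        rw [← hG i (by omega)]
        simp [Slice.pos]) hu μ hμ)
    obtain ⟨τ, t, e1, j1, ⟨v, ⟨R, hR, hv⟩, hτ⟩, f1, t1⟩ := hrun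
    simp only at hτ
    simp only [Slice.pos, if_true] at hτ
    simp only at f1
    have hinvτ : ∀ i < k, τ.mem .out (n - 1 - i) = .elt (R.coeff i) := fun i hi => by
      rw [← hv i hi, ← hτ i hi]
      congr 1
      omega
    -- The first quotient is the Karp–Markstein step from precision `0`, where the residual `D` is
    -- just the beginning of `F`.
    obtain ⟨D, Q, hD, hQd, -, hQ, hQF⟩ := exists_quotient_add (F := F) (G := G) (Q := 0) (k := 0)
      (l := k) (R := R) (by simp) (by simp) hR
    simp only [Nat.zero_add] at hQd hQ hQF
    have hD' : ∀ t < k, D.coeff t = F.coeff t := fun t ht => by simp [hD t ht]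
    have hrun := WP.run (B := B) (len := len) (σ := τ) (p := sp) (m := Alg.k) (N := k)
      (T := Ts k)
      (x := Alg.fwd .in₁ (.const 0) Alg.k) (y := Alg.bwd .out (.sub Alg.n Alg.k) Alg.k)
      (z := Alg.fwd .out (.const 0) Alg.k)
      (w := Alg.fwd .out Alg.k (.floorMul cs Alg.k))
      (sx := ⟨.in₁, 0, k, false⟩) (sy := ⟨.out, n - k, k, true⟩)
      (sz := ⟨.out, 0, k, false⟩) (sw := ⟨.out, k, ⌊cs * (k : ℝ)⌋₊, false⟩)
      (Φ := fun v => ∀ i < k, v i = .elt ((D * R).coeff i))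
      (by simp [View.eval, Alg.fwd, IExp.eval, Alg.k, i1, j1])
      (by simp [View.eval, Alg.bwd, IExp.eval, Alg.n, Alg.k, i0, i1, j1])
      (by simp [View.eval, Alg.fwd, IExp.eval, Alg.k, i1, j1])
      (by simp [View.eval, Alg.fwd, IExp.eval, Alg.k, i1, j1])
      (by simp [IExp.eval, Alg.k, i1, j1]) (by omega)
      (by simp only; omega) (by simp only; omega) (by simp only; omega) (by simp only; omega) hes
      trivial trivial (.inl nofun) (.inr (.inl (by simp only; omega)))
      (.inr (.inl (by simp only; omega))) (.inl nofun)
      (.inl nofun) (.inr (.inl (by simp only; omega))) (.inl nofun) (.inl nofun) (.inl nofun)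
      ((hsp k k0 (by omega)).exec (fun i hi => by
        simp only [Slice.pos, Bool.false_eq_true, if_false, Nat.zero_add]
        rw [hD' i hi, ← hF i (by omega)]
        exact f1 _ _ nofun nofun nofun) (fun i hi => by
        simp only [Slice.pos, if_true]
        rw [← hinvτ i hi]
        congr 1
        omega))
    obtain ⟨υ, s, e2, j2, ⟨v', hv', hυ⟩, f2, t2⟩ := hrun
    simp only at hυ
    simp only [Slice.pos, Bool.false_eq_true, if_false, Nat.zero_add] at hυ
    simp only at f2
    refine ⟨υ, t + s, .cond_true (by simp only [IExp.eval, Alg.k, i1]; omega) (.seq e1 e2),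
      ⟨R, hR, by rw [j2, j1, i0], by rw [j2, j1, i1], by omega, ?_, ?_, ⟨Q, hQd, ?_, hQF⟩, ?_⟩, ?_⟩
    · intro i hi
      rw [← hF i hi, f2 .in₁ _ nofun nofun nofun, f1 .in₁ _ nofun nofun nofun]
    · intro i hi
      rw [← hG i hi, f2 .in₂ _ nofun nofun nofun, f1 .in₂ _ nofun nofun nofun]
    · intro i hi
      rw [hQ i hi, ← hv' i hi, hυ i hi]
    · intro i hi
      rw [← hinvτ i (by omega)]
      exact f2 _ _ (by omega) (by omega) nofun
    · rw [if_neg (by omega)]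
      push_cast
      linarith

end

/-! ### The last coefficients, computed in the extra registers -/

section

variable {K : Type*} [CommRing K] {B : ℕ} {len : Arr → ℕ}

/-- The inner products of the last step. -/
theorem WP.innerProducts {n k l s : ℕ} {F G Q : ℕ → K} {σ : Store K}
    (hlB : l ≤ B) (hkB : k ≤ B) (h₁ : len .in₁ = n) (h₂ : len .in₂ = n) (ho : len .out = n)
    (he : s + 1 + l ≤ len .extra) (hkl : k + l = n) (i1 : σ.idx 1 = k) (i2 : σ.idx 2 = l)
    (hF : ∀ i < n, σ.mem .in₁ i = .elt (F i)) (hG : ∀ i < n, σ.mem .in₂ i = .elt (G i))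
    (hQ : ∀ i < k, σ.mem .out i = .elt (Q i)) :
    WP B len (Alg.for' 3 Alg.ℓ
      (.seq (.copy .extra (.add (.const (s + 1)) Alg.i) .in₁ (.add Alg.k Alg.i))
        (Alg.for' 4 Alg.k
          (.seq (.arith .mul .extra (.const s) .in₂ (.sub (.add Alg.k Alg.i) Alg.j) .out Alg.j)
            (.arith .sub .extra (.add (.const (s + 1)) Alg.i)
              .extra (.add (.const (s + 1)) Alg.i) .extra (.const s)))))) σ
      fun τ t => (τ.idx 1 = k ∧ τ.idx 2 = l) ∧
        (∀ i < l, τ.mem .extra (s + 1 + i) =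
          .elt (F (k + i) - ∑ u ∈ Finset.range k, G (k + i - u) * Q u)) ∧
        (∀ a j, (a = .extra → s + 1 + l ≤ j) → τ.mem a j = σ.mem a j) ∧
        t ≤ l * (k * 2) := by
  refine (WP.for' (w := k * 2) (fun i τ => (τ.idx 1 = k ∧ τ.idx 2 = l ∧ τ.idx 3 = i) ∧
    (∀ i' < i, τ.mem .extra (s + 1 + i') =
      .elt (F (k + i') - ∑ u ∈ Finset.range k, G (k + i' - u) * Q u)) ∧
    (∀ a j, (a = .extra → s + 1 + l ≤ j) → τ.mem a j = σ.mem a j)) hlB ?_ ?_ ?_).mono ?_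
  · exact ⟨⟨by simp [Store.setIdx, i1], by simp [Store.setIdx, i2], by simp [Store.setIdx]⟩,
      nofun, fun _ _ _ => rfl⟩
  · rintro i τ ⟨⟨j1, j2, j3⟩, -⟩
    exact ⟨j2, j3⟩
  · rintro i τ hi ⟨⟨j1, j2, j3⟩, m1, f1⟩
    have e1 : Exec B len (.copy .extra (.add (.const (s + 1)) Alg.i) .in₁ (.add Alg.k Alg.i)) τ
        (τ.setCell .extra (s + 1 + i) (.elt (F (k + i)))) 0 := by
      refine exec_copy (y := k + i) trivial ?_ ?_ ?_ ?_ ?_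
      · simp [IExp.eval, Alg.i, j3]
      · omega
      · simp [IExp.eval, Alg.k, Alg.i, j1, j3]
      · omega
      · rw [f1 .in₁ _ nofun, hF _ (by omega)]
    set τ' := τ.setCell .extra (s + 1 + i) (.elt (F (k + i))) with hτ'
    have hloop := WP.for' (B := B) (len := len) (σ := τ') (reg := 4) (N := k) (w := 2)
      (bound := Alg.k)
      (c := .seq (.arith .mul .extra (.const s) .in₂ (.sub (.add Alg.k Alg.i) Alg.j) .out Alg.j)
        (.arith .sub .extra (.add (.const (s + 1)) Alg.i)
          .extra (.add (.const (s + 1)) Alg.i) .extra (.const s)))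
      -- The scratch register `s` does not appear in the invariant, since each turn overwrites it
      -- before reading it.
      (fun j υ => (υ.idx 1 = k ∧ υ.idx 2 = l ∧ υ.idx 3 = i ∧ υ.idx 4 = j) ∧
        (∀ i' < i, υ.mem .extra (s + 1 + i') =
          .elt (F (k + i') - ∑ u ∈ Finset.range k, G (k + i' - u) * Q u)) ∧
        υ.mem .extra (s + 1 + i) =
          .elt (F (k + i) - ∑ u ∈ Finset.range j, G (k + i - u) * Q u) ∧
        (∀ a j, (a = .extra → s + 1 + l ≤ j) → υ.mem a j = σ.mem a j)) hkB ?_ ?_ ?_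
    · obtain ⟨υ, t, e2, ⟨⟨k1, k2, k3, k4⟩, m2, m3, f2⟩, t2⟩ := hloop
      refine ⟨υ, 0 + t, .seq e1 e2, ⟨⟨by simp [Store.setIdx, k1], by simp [Store.setIdx, k2],
        by simp [Store.setIdx]⟩, ?_, f2⟩, k3, by omega⟩
      intro i' hi'
      rcases Nat.lt_succ_iff_lt_or_eq.1 hi' with h | rfl
      · exact m2 i' h
      · exact m3
    · refine ⟨⟨by simp [Store.setIdx, hτ', Store.setCell, j1],
        by simp [Store.setIdx, hτ', Store.setCell, j2],
        by simp [Store.setIdx, hτ', Store.setCell, j3], by simp [Store.setIdx]⟩, ?_, ?_, ?_⟩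
      · intro i' hi'
        rw [← m1 i' hi']
        simp only [Store.setIdx, hτ', Store.setCell, Function.update_self]
        rw [Function.update_of_ne (by omega)]
      · simp [Store.setIdx, hτ', Store.setCell]
      · intro a j ha
        rw [← f1 a j ha]
        simp only [Store.setIdx, hτ', Store.setCell]
        by_cases h : a = .extra
        · subst h
          rw [Function.update_self, Function.update_of_ne]
          have := ha rfl
          omega
        · rw [Function.update_of_ne h]
    · rintro j υ ⟨⟨k1, k2, k3, k4⟩, -⟩
      exact ⟨k1, k4⟩
    · rintro j υ hj ⟨⟨k1, k2, k3, k4⟩, m2, m3, f2⟩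
      have e2 : Exec B len
          (.arith .mul .extra (.const s) .in₂ (.sub (.add Alg.k Alg.i) Alg.j) .out Alg.j) υ
          (υ.setCell .extra s (.elt (G (k + i - j) * Q j))) 1 := by
        refine exec_arith (o := .mul) (x := s) (y := k + i - j) (y' := j)
          trivial rfl ?_ ?_ ?_ ?_ ?_ ?_ ?_
        · omega
        · simp [IExp.eval, Alg.k, Alg.i, Alg.j, k1, k3, k4]
        · omega
        · simp [IExp.eval, Alg.j, k4]
        · omega
        · rw [f2 .in₂ _ nofun, hG _ (by omega)]
        · rw [f2 .out _ nofun, hQ _ hj]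
      have e3 : Exec B len (.arith .sub .extra (.add (.const (s + 1)) Alg.i)
          .extra (.add (.const (s + 1)) Alg.i) .extra (.const s))
          (υ.setCell .extra s (.elt (G (k + i - j) * Q j)))
          ((υ.setCell .extra s (.elt (G (k + i - j) * Q j))).setCell .extra (s + 1 + i)
            (.elt (F (k + i) - ∑ u ∈ Finset.range j, G (k + i - u) * Q u -
              G (k + i - j) * Q j))) 1 := by
        refine exec_arith (o := .sub) (x := s + 1 + i) (y := s + 1 + i) (y' := s)
          trivial ?_ ?_ ?_ ?_ rfl ?_ ?_ ?_
        · simp [IExp.eval, Alg.i, Store.setCell, k3]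
        · omega
        · simp [IExp.eval, Alg.i, Store.setCell, k3]
        · omega
        · omega
        · simp only [Store.setCell, Function.update_self]
          rw [Function.update_of_ne (by omega), m3]
        · simp [Store.setCell]
      refine ⟨_, _, .seq e2 e3, ⟨⟨by simp [Store.setIdx, Store.setCell, k1],
        by simp [Store.setIdx, Store.setCell, k2], by simp [Store.setIdx, Store.setCell, k3],
        by simp [Store.setIdx]⟩, ?_, ?_, ?_⟩, by simp [Store.setCell, k4], le_rfl⟩
      · intro i' hi'
        rw [← m2 i' hi']
        simp only [Store.setIdx, Store.setCell, Function.update_self]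
        rw [Function.update_of_ne (by omega), Function.update_of_ne (by omega)]
      · simp only [Store.setIdx, Store.setCell, Function.update_self]
        rw [Finset.sum_range_succ, sub_add_eq_sub_sub]
      · intro a j' ha
        rw [← f2 a j' ha]
        simp only [Store.setIdx, Store.setCell]
        by_cases h : a = .extra
        · subst h
          have := ha rfl
          rw [Function.update_self, Function.update_self, Function.update_of_ne (by omega),
            Function.update_of_ne (by omega)]
        · rw [Function.update_of_ne h, Function.update_of_ne h]
  · rintro τ t ⟨⟨⟨j1, j2, -⟩, m1, f1⟩, ht⟩
    exact ⟨⟨j1, j2⟩, m1, f1, ht⟩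

/-- The same Karp–Markstein step with `l = n - k`, but no free output registers are left besides the
target. The residual, a newly computed inverse and the work space therefore live in the extra
registers, above the first `s`, which contain those lent to the routines. -/
theorem WP.finish {sp inv : Routine} {c cs ci Ts Ti : ℝ} {n k l s : ℕ} {F G R : K[X]}
    {σ : Store K} (hnB : n ≤ B) (h₁ : len .in₁ = n) (h₂ : len .in₂ = n) (ho : len .out = n)
    (hes : sp.extra ≤ s) (hei : inv.extra ≤ s)
    (hls : s + 1 + 2 * l + ⌊cs * (l : ℝ)⌋₊ ≤ len .extra)
    (hli : s + 1 + 2 * l + ⌊ci * (l : ℝ)⌋₊ ≤ len .extra) (hkl : k + l = n)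
    (hsp : ShortProductAt K sp Ts cs B l) (hinv : InversionAt K inv Ti ci B l)
    (hσ : Invariant n c F G R k σ) (hu : IsUnit (G.coeff 0)) :
    WP B len (Alg.finish sp inv cs ci s) σ fun τ t =>
      (∃ Q : K[X], Holds τ.mem .out n Q ∧ X ^ n ∣ F - G * Q) ∧
        (t : ℝ) ≤ Ti + (l * (k * 2) : ℕ) + Ts := by
  obtain ⟨i0, i1, hkn, hF, hG, ⟨Q, hQd, hQ, hQF⟩, -⟩ := hσ
  have l0 : 0 < l := by omega
  refine WP.assign_seq (v := l) (by simp [IExp.eval, Alg.n, Alg.k, i0, i1]; omega) (by omega) ?_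
  set σ' := σ.setIdx 2 l with hσ'
  have i1' : σ'.idx 1 = k := by simp [hσ', Store.setIdx, i1]
  have i2 : σ'.idx 2 = l := by simp [hσ', Store.setIdx]
  have hm' : σ'.mem = σ.mem := rfl
  rw [← hm'] at hF hG hQ
  have hrun := WP.run (B := B) (len := len) (σ := σ') (p := inv) (m := Alg.ℓ) (N := l)
    (T := Ti)
    (x := Alg.fwd .in₂ (.const 0) Alg.ℓ) (y := Alg.fwd .in₂ (.const 0) (.const 0))
    (z := Alg.fwd .extra (.add (.const (s + 1)) Alg.ℓ) Alg.ℓ)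
    (w := Alg.fwd .extra (.add (.const (s + 1)) (.mul (.const 2) Alg.ℓ)) (.floorMul ci Alg.ℓ))
    (sx := ⟨.in₂, 0, l, false⟩) (sy := ⟨.in₂, 0, 0, false⟩)
    (sz := ⟨.extra, s + 1 + l, l, false⟩)
    (sw := ⟨.extra, s + 1 + 2 * l, ⌊ci * (l : ℝ)⌋₊, false⟩)
    (Φ := fun v => ∃ R : K[X], X ^ l ∣ 1 - G * R ∧ ∀ i < l, v i = .elt (R.coeff i))
    (by simp [View.eval, Alg.fwd, IExp.eval, Alg.ℓ, i2])
    (by simp [View.eval, Alg.fwd, IExp.eval])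
    (by simp [View.eval, Alg.fwd, IExp.eval, Alg.ℓ, i2])
    (by simp [View.eval, Alg.fwd, IExp.eval, Alg.ℓ, i2])
    (by simp [IExp.eval, Alg.ℓ, i2]) (by omega)
    (by simp only; omega) (by simp only; omega) (by simp only; omega) (by simp only; omega)
    (by omega)
    trivial trivial (.inl nofun) (.inl nofun) (.inr (.inl (by simp only; omega)))
    (.inr (.inr (by simp only; omega)))
    (.inl nofun) (.inl nofun) (.inr (.inr (by simp only; omega))) (.inl nofun) (.inl nofun)
    (fun μ hμ _ => hinv.exec l0 (fun i hi => by
      rw [← hG i (by omega)]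
      simp [Slice.pos]) hu μ hμ)
  refine WP.seq hrun ?_
  rintro τ t ⟨j0, ⟨v, ⟨R', hR, hv⟩, hτ⟩, f1, t1⟩
  simp only at hτ
  simp only [Slice.pos, Bool.false_eq_true, if_false] at hτ
  simp only at f1
  have f1' : ∀ a j, a ≠ .extra → τ.mem a j = σ'.mem a j := fun a j ha =>
    f1 a j (fun h => ha h.1) (fun h => ha h.1) (fun h => ha h.1)
  refine WP.seq (WP.innerProducts (n := n) (k := k) (l := l) (s := s) (F := F.coeff)
    (G := G.coeff) (Q := Q.coeff) (by omega) (by omega) h₁ h₂ ho (by omega) hkl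
    (by rw [j0, i1']) (by rw [j0, i2])
    (fun i hi => by rw [f1' .in₁ _ nofun, hF i hi])
    (fun i hi => by rw [f1' .in₂ _ nofun, hG i hi])
    (fun i hi => by rw [f1' .out _ nofun, hQ i hi])) ?_
  rintro υ t' ⟨⟨k1, k2⟩, m2, f2, t2⟩
  obtain ⟨D, Q', hD, hQd', hQ'1, hQ'2, hQF'⟩ := exists_quotient_add hQd hQF hR
  refine (WP.run (B := B) (len := len) (σ := υ) (p := sp) (m := Alg.ℓ) (N := l)
    (T := Ts)
    (x := Alg.fwd .extra (.const (s + 1)) Alg.ℓ)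
    (y := Alg.fwd .extra (.add (.const (s + 1)) Alg.ℓ) Alg.ℓ)
    (z := Alg.fwd .out Alg.k Alg.ℓ)
    (w := Alg.fwd .extra (.add (.const (s + 1)) (.mul (.const 2) Alg.ℓ)) (.floorMul cs Alg.ℓ))
    (sx := ⟨.extra, s + 1, l, false⟩) (sy := ⟨.extra, s + 1 + l, l, false⟩)
    (sz := ⟨.out, k, l, false⟩)
    (sw := ⟨.extra, s + 1 + 2 * l, ⌊cs * (l : ℝ)⌋₊, false⟩)
    (Φ := fun v => ∀ i < l, v i = .elt ((D * R').coeff i))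
    (by simp [View.eval, Alg.fwd, IExp.eval, Alg.ℓ, k2])
    (by simp [View.eval, Alg.fwd, IExp.eval, Alg.ℓ, k2])
    (by simp [View.eval, Alg.fwd, IExp.eval, Alg.k, Alg.ℓ, k1, k2])
    (by simp [View.eval, Alg.fwd, IExp.eval, Alg.ℓ, k2])
    (by simp [IExp.eval, Alg.ℓ, k2]) (by omega)
    (by simp only; omega) (by simp only; omega) (by simp only; omega) (by simp only; omega)
    (by omega)
    trivial trivial (.inl nofun) (.inl nofun) (.inl nofun) (.inl nofun)
    (.inr (.inr (by simp only; omega))) (.inr (.inr (by simp only; omega)))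
    (.inr (.inr (by simp only; omega))) (.inr (.inr (by simp only; omega)))
    (.inr (.inr (by simp only; omega)))
    (hsp.exec (fun i hi => by
      simp only [Slice.pos, Bool.false_eq_true, if_false]
      rw [m2 i hi, hD i hi]) (fun i hi => by
      simp only [Slice.pos, Bool.false_eq_true, if_false]
      rw [f2 .extra _ (fun _ => by omega), hτ i hi, hv i hi]))).mono ?_
  rintro ω t'' ⟨-, ⟨v', hv', hω⟩, f3, t3⟩
  simp only at hω
  simp only [Slice.pos, Bool.false_eq_true, if_false] at hω
  simp only at f3
  rw [hkl] at hQd' hQF'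
  refine ⟨⟨Q', ⟨hQd', fun i hi => ?_⟩, hQF'⟩, ?_⟩
  · rcases lt_or_ge i k with h | h
    · rw [hQ'1 i h, f3 .out _ (by omega) nofun nofun, f2 .out _ nofun, f1' .out _ nofun, hQ i h]
    · obtain ⟨t, rfl⟩ := Nat.exists_eq_add_of_le h
      rw [hQ'2 t (by omega), ← hv' t (by omega)]
      exact hω t (by omega)
  · have : (t' : ℝ) ≤ (l * (k * 2) : ℕ) := by exact_mod_cast t2
    push_cast at this ⊢
    linarith

end

/-! ### The number of operations -/

section cost

variable {M : ℕ → ℝ}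

/-- The hypothesis with `α = n / m`: the quotient `M m / m` is nondecreasing. -/
theorem cost_mul_le (hM : ∀ (α : ℝ) (m n : ℕ), 1 ≤ α → 1 ≤ m → (n : ℝ) = α * (m : ℝ) →
    α * M m ≤ M n) {m n : ℕ} (hm : 1 ≤ m) (hmn : m ≤ n) : n * M m ≤ m * M n := by
  have h0 : (0 : ℝ) < m := by exact_mod_cast hm
  have h1 := hM (n / m) m n (by rw [le_div_iff₀ h0, one_mul]; exact_mod_cast hmn) hm
    (by field_simp)
  rw [div_mul_eq_mul_div, div_le_iff₀ h0] at h1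
  linarith

theorem cost_mono (hMpos : ∀ n : ℕ, 1 ≤ n → 0 < M n)
    (hM : ∀ (α : ℝ) (m n : ℕ), 1 ≤ α → 1 ≤ m → (n : ℝ) = α * (m : ℝ) →
    α * M m ≤ M n) {m n : ℕ} (hm : 1 ≤ m) (hmn : m ≤ n) : M m ≤ M n := by
  have h1 := cost_mul_le hM hm hmn
  have h2 : (m : ℝ) ≤ n := by exact_mod_cast hmn
  have h3 : (0 : ℝ) < m := by exact_mod_cast hm
  have h4 := hMpos m hm
  refine le_of_mul_le_mul_left ?_ h3
  nlinarith

/-- Linear work is `O(M n)`, with a constant valid for all `n ≥ 1`. -/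
theorem le_cost (hM : ∀ (α : ℝ) (m n : ℕ), 1 ≤ α → 1 ≤ m → (n : ℝ) = α * (m : ℝ) →
    α * M m ≤ M n) (hMpos : ∀ n : ℕ, 1 ≤ n → 0 < M n) {n : ℕ} (hn : 1 ≤ n) :
    (n : ℝ) ≤ 1 / M 1 * M n := by
  have h1 := cost_mul_le hM le_rfl hn
  have h2 := hMpos 1 le_rfl
  rw [div_mul_eq_mul_div, le_div_iff₀ h2]
  simpa using h1

theorem lt_newCoeffs_succ {c : ℝ} (hc : 0 ≤ c) (x : ℕ) :
    (x : ℝ) < (3 + c) * (newCoeffs c x + 1) := by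
  rw [← div_lt_iff₀' (by positivity)]
  exact Nat.lt_floor_add_one _

theorem newCoeffs_eq_zero {c : ℝ} (hc : 0 ≤ c) {x : ℕ} : newCoeffs c x = 0 ↔ (x : ℝ) < 3 + c := by
  rw [newCoeffs, Nat.floor_eq_zero, div_lt_one (by positivity)]

theorem loopCost_of_eq_zero {Tm Ts : ℕ → ℝ} {c : ℝ} {n x : ℕ} (h : newCoeffs c x = 0) :
    loopCost Tm Ts c n x = 0 := by
  rw [loopCost, dif_neg (by omega)]

theorem loopCost_of_pos {Tm Ts : ℕ → ℝ} {c : ℝ} (hc : 0 ≤ c) {n x : ℕ}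
    (h : 0 < newCoeffs c x) :
    loopCost Tm Ts c n x =
      ((((n - x) / newCoeffs c x : ℕ) + 1) * Tm (newCoeffs c x) + n + Ts (newCoeffs c x))
        + loopCost Tm Ts c n (x - newCoeffs c x) := by
  rw [loopCost, dif_pos ⟨h, h.trans_le (newCoeffs_le hc x)⟩]

theorem blocks_mul_le {c : ℝ} (hc : 0 ≤ c) {n x : ℕ} (hx : x ≤ n) :
    ((n - x) / newCoeffs c x + 1) * newCoeffs c x ≤ n := by
  have h1 := Nat.div_mul_le_self (n - x) (newCoeffs c x)
  have h2 := newCoeffs_le hc x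
  rw [add_mul]
  omega

/-- The blocks of one iteration have total length at most `n`, so their middle products together
cost at most one product of size `n`. The short product is charged in proportion to `newCoeffs c x /
n`, a form that telescopes over the iterations. -/
theorem loopCost_le_step (hM : ∀ (α : ℝ) (m n : ℕ), 1 ≤ α → 1 ≤ m → (n : ℝ) = α * (m : ℝ) →
    α * M m ≤ M n) (hMpos : ∀ n : ℕ, 1 ≤ n → 0 < M n) {lm ls c : ℝ} (hlm : 0 ≤ lm)
    (hls : 0 ≤ ls) (hc : 0 ≤ c) {n x : ℕ} (hx : x ≤ n) (h : 0 < newCoeffs c x) :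
    loopCost (fun m => lm * M m) (fun m => ls * M m) c n x ≤
      lm * M n + n + ls * M n * (newCoeffs c x / n)
        + loopCost (fun m => lm * M m) (fun m => ls * M m) c n (x - newCoeffs c x) := by
  have h1 := blocks_mul_le hc hx
  have h2 := newCoeffs_le hc x
  rw [loopCost_of_pos hc h]
  generalize newCoeffs c x = l at *
  generalize (n - x) / l = q at *
  have hn0 : (0 : ℝ) < n := by exact_mod_cast (by omega)
  have hMn := hMpos n (by omega)
  have h3 : n * M l ≤ l * M n := cost_mul_le hM h (by omega)
  have h5 : ((q : ℝ) + 1) * l ≤ n := by exact_mod_cast h1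
  have h4 : ((q : ℝ) + 1) * M l ≤ M n := by
    refine le_of_mul_le_mul_left ?_ hn0
    nlinarith
  have h6 : M l ≤ M n * (l / n) := by
    rw [← mul_div_assoc, le_div_iff₀ hn0]
    linarith
  have h7 := mul_le_mul_of_nonneg_left h4 hlm
  have h8 := mul_le_mul_of_nonneg_left h6 hls
  linarith

/-- The number of iterations is at most `log_{(c + 3) / (c + 2)} (x - (c + 3)) + 2`. -/
theorem loopCost_le_log (hM : ∀ (α : ℝ) (m n : ℕ), 1 ≤ α → 1 ≤ m → (n : ℝ) = α * (m : ℝ) →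
    α * M m ≤ M n) (hMpos : ∀ n : ℕ, 1 ≤ n → 0 < M n) {lm ls c : ℝ} (hlm : 0 ≤ lm)
    (hls : 0 ≤ ls) (hc : 0 ≤ c) {n : ℕ} (hn : 1 ≤ n) (x : ℕ) (hx : x ≤ n) :
    ((x : ℝ) - (c + 3) < 1 → loopCost (fun m => lm * M m) (fun m => ls * M m) c n x ≤
      (lm * M n + n) + ls * M n * (x / n)) ∧
    (1 ≤ (x : ℝ) - (c + 3) → loopCost (fun m => lm * M m) (fun m => ls * M m) c n x ≤
      (lm * M n + n) * (Real.logb ((c + 3) / (c + 2)) (x - (c + 3)) + 2)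
        + ls * M n * (x / n)) := by
  have hn0 : (0 : ℝ) < n := by exact_mod_cast hn
  have hMn := hMpos n hn
  have hA : 0 ≤ lm * M n + n := by positivity
  have hβ : 1 < (c + 3) / (c + 2) := by rw [one_lt_div (by positivity)]; linarith
  -- The telescoping of the short products: the share of `x` is that of the current iteration plus
  -- that of the coefficients still missing.
  have hsplit : ∀ x : ℕ, ls * M n * ((x : ℝ) / n) = ls * M n * (newCoeffs c x / n) +
      ls * M n * ((x - newCoeffs c x : ℕ) / n) := by
    intro x
    rw [Nat.cast_sub (newCoeffs_le hc x)]
    ring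
  -- Below `c + 4` missing coefficients, a single iteration leads below `c + 3`, where the loop
  -- stops.
  have small : ∀ x : ℕ, x ≤ n → (x : ℝ) - (c + 3) < 1 →
      loopCost (fun m => lm * M m) (fun m => ls * M m) c n x ≤
        (lm * M n + n) + ls * M n * (x / n) := by
    intro x hx hy
    rcases Nat.eq_zero_or_pos (newCoeffs c x) with h | h
    · rw [loopCost_of_eq_zero h]
      positivity
    · have h1 := loopCost_le_step hM hMpos hlm hls hc hx h
      rw [loopCost_of_eq_zero (x := x - newCoeffs c x)] at h1
      · have h2 : 0 ≤ ls * M n * (((x - newCoeffs c x : ℕ) : ℝ) / n) := by positivity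
        rw [hsplit x]
        linarith
      · rw [newCoeffs_eq_zero hc, Nat.cast_sub (newCoeffs_le hc x)]
        have : (1 : ℝ) ≤ newCoeffs c x := by exact_mod_cast h
        linarith
  refine ⟨small x hx, ?_⟩
  induction x using Nat.strong_induction_on with
  | _ x ih =>
    intro hy
    have h : 0 < newCoeffs c x := by
      rw [Nat.pos_iff_ne_zero, Ne, newCoeffs_eq_zero hc]
      linarith
    have hle := newCoeffs_le hc x
    have h1 := loopCost_le_step hM hMpos hlm hls hc hx h
    have hlt := lt_newCoeffs_succ hc x
    have hlog : 0 ≤ Real.logb ((c + 3) / (c + 2)) (x - (c + 3)) := Real.logb_nonneg hβ hy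
    rw [hsplit x]
    rcases lt_or_ge (((x - newCoeffs c x : ℕ) : ℝ) - (c + 3)) 1 with h2 | h2
    · have h3 := small _ (by omega) h2
      nlinarith
    · have h3 := ih _ (by omega) (by omega) h2
      -- From `x < (c + 3) * (l + 1)` with `l = newCoeffs c x`, the quantity `x - (c + 3)` shrinks
      -- at least by the factor `(c + 2) / (c + 3)`. The shift `c + 3` is the fixed point of `x ↦ x
      -- * (c + 2) / (c + 3) + 1`, and so absorbs the rounding.
      have h4 : Real.logb ((c + 3) / (c + 2)) ((x - newCoeffs c x : ℕ) - (c + 3)) ≤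
          Real.logb ((c + 3) / (c + 2)) (x - (c + 3)) - 1 := by
        rw [← Real.logb_self_eq_one hβ, ← Real.logb_div (by linarith) (by linarith)]
        refine Real.logb_le_logb_of_le hβ (by linarith) ?_
        rw [le_div_iff₀ (by linarith), mul_div_assoc', div_le_iff₀ (by linarith),
          Nat.cast_sub hle]
        nlinarith
      have h5 := mul_le_mul_of_nonneg_left h4 hA
      linarith

theorem loopCost_le (hM : ∀ (α : ℝ) (m n : ℕ), 1 ≤ α → 1 ≤ m → (n : ℝ) = α * (m : ℝ) →
    α * M m ≤ M n) (hMpos : ∀ n : ℕ, 1 ≤ n → 0 < M n) {lm ls c : ℝ} (hlm : 0 ≤ lm)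
    (hls : 0 ≤ ls) (hc : 0 ≤ c) {n : ℕ} (hn : 1 ≤ n) {x : ℕ} (hx : x ≤ n) :
    loopCost (fun m => lm * M m) (fun m => ls * M m) c n x ≤
      (lm * M n + n) * (Real.logb ((c + 3) / (c + 2)) n + 2) + ls * M n := by
  have hn0 : (1 : ℝ) ≤ n := by exact_mod_cast hn
  have hxn : (x : ℝ) ≤ n := by exact_mod_cast hx
  have hMn := hMpos n hn
  have hA : 0 ≤ lm * M n + n := by positivity
  have hβ : 1 < (c + 3) / (c + 2) := by rw [one_lt_div (by positivity)]; linarith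
  have hlog : 0 ≤ Real.logb ((c + 3) / (c + 2)) n := Real.logb_nonneg hβ hn0
  have h0 : ls * M n * (x / n) ≤ ls * M n :=
    mul_le_of_le_one_right (by positivity) ((div_le_one (by linarith)).2 hxn)
  obtain ⟨h1, h2⟩ := loopCost_le_log hM hMpos hlm hls hc hn x hx
  rcases lt_or_ge ((x : ℝ) - (c + 3)) 1 with h | h
  · have h3 := h1 h
    nlinarith
  · have h3 := h2 h
    have h4 := mul_le_mul_of_nonneg_left (Real.logb_le_logb_of_le (b := (c + 3) / (c + 2)) hβ
      (by linarith) (by linarith : (x : ℝ) - (c + 3) ≤ n)) hA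
    linarith

/-- For costs of the order of `n ^ (1 + γ)` the costs of the iterations decrease geometrically. -/
theorem exists_loopCost_le_rpow {lm ls c γ C : ℝ} (hlm : 0 ≤ lm) (hls : 0 ≤ ls) (hc : 0 ≤ c)
    (hγ : 0 < γ) (hC : 0 ≤ C) (hMC : ∀ l : ℕ, 1 ≤ l → M l ≤ C * (l : ℝ) ^ (1 + γ)) :
    ∃ A : ℝ, ∀ n x : ℕ, x ≤ n →
      loopCost (fun m => lm * M m) (fun m => ls * M m) c n x ≤ A * (n * (x : ℝ) ^ γ) := by
  -- As long as `l ≥ 1`, one has `x < (c + 3) * (l + 1) ≤ 2 * (c + 3) * l`; the factor `2` pays for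
  -- the rounding, and at most `q * x` coefficients remain.
  set q : ℝ := 1 - 1 / (2 * (c + 3)) with hq
  have hq1 : q < 1 := by
    have : 0 < 1 / (2 * (c + 3)) := by positivity
    linarith
  have hq0 : 0 < q := by
    have : 1 / (2 * (c + 3)) < 1 := by rw [div_lt_one (by positivity)]; linarith
    linarith
  have hqγ : q ^ γ < 1 := Real.rpow_lt_one hq0.le hq1 hγ
  set D : ℝ := (lm + ls) * C + 1 with hD
  have hD0 : 0 ≤ D := by positivity
  -- The sum of the geometric series of ratio `q ^ γ`, that is, the solution of `A = A * q ^ γ + D`,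
  -- where `D` bounds the cost of one iteration in units of `n * x ^ γ`.
  set A : ℝ := D / (1 - q ^ γ) with hA
  have hA0 : 0 ≤ A := div_nonneg hD0 (by linarith)
  have hAD : A * q ^ γ + D = A := by
    have : A * (1 - q ^ γ) = D := div_mul_cancel₀ _ (by linarith)
    linarith
  refine ⟨A, fun n x => ?_⟩
  induction x using Nat.strong_induction_on with
  | _ x ih =>
    intro hx
    rcases Nat.eq_zero_or_pos (newCoeffs c x) with h | h
    · rw [loopCost_of_eq_zero h]
      positivity
    · have hle := newCoeffs_le hc x
      have h1 := blocks_mul_le hc hx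
      have hlt := lt_newCoeffs_succ hc x
      have h2 := ih (x - newCoeffs c x) (by omega) (by omega)
      rw [loopCost_of_pos hc h]
      generalize newCoeffs c x = l at *
      generalize (n - x) / l = b at *
      have hl1 : (1 : ℝ) ≤ l := by exact_mod_cast h
      have hlx : (l : ℝ) ≤ x := by exact_mod_cast hle
      have hxn : (x : ℝ) ≤ n := by exact_mod_cast hx
      have hb : ((b : ℝ) + 1) * l ≤ n := by exact_mod_cast h1
      have hxq : ((x - l : ℕ) : ℝ) ≤ q * x := by
        rw [Nat.cast_sub hle, hq, sub_mul, one_mul, sub_le_sub_iff_left, div_mul_eq_mul_div,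
          div_le_iff₀ (by positivity)]
        nlinarith
      have h3 : ((x - l : ℕ) : ℝ) ^ γ ≤ q ^ γ * (x : ℝ) ^ γ := by
        rw [← Real.mul_rpow hq0.le (by positivity)]
        gcongr
      have hX1 : (1 : ℝ) ≤ (x : ℝ) ^ γ := Real.one_le_rpow (hl1.trans hlx) hγ.le
      have hLX : (l : ℝ) ^ γ ≤ (x : ℝ) ^ γ := by gcongr
      have hML : M l ≤ C * (l * (x : ℝ) ^ γ) := by
        refine (hMC l h).trans ?_
        rw [Real.rpow_add (by linarith), Real.rpow_one]
        gcongr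
      generalize (x : ℝ) ^ γ = Y at *
      -- One factor `l` of `l ^ (1 + γ)` combines with the number of blocks to give at most `n`; the
      -- remaining `l ^ γ` is at most `x ^ γ`.
      have h4 : ((b : ℝ) + 1) * (lm * M l) ≤ lm * C * (n * Y) := by
        calc ((b : ℝ) + 1) * (lm * M l) ≤ ((b : ℝ) + 1) * (lm * (C * (l * Y))) := by gcongr
          _ = lm * C * ((((b : ℝ) + 1) * l) * Y) := by ring
          _ ≤ lm * C * (n * Y) := by gcongr
      have h5 : ls * M l ≤ ls * C * (n * Y) := by
        calc ls * M l ≤ ls * (C * (l * Y)) := by gcongr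
          _ = ls * C * (l * Y) := by ring
          _ ≤ ls * C * (n * Y) := by
            gcongr
            exact hle.trans hx
      have h6 : (n : ℝ) ≤ n * Y := le_mul_of_one_le_right (by positivity) hX1
      have h7 : A * (n * ((x - l : ℕ) : ℝ) ^ γ) ≤ A * q ^ γ * (n * Y) := by
        calc A * (n * ((x - l : ℕ) : ℝ) ^ γ) ≤ A * (n * (q ^ γ * Y)) := by gcongr
          _ = A * q ^ γ * (n * Y) := by ring
      have h8 : A * (n * Y) = A * q ^ γ * (n * Y) + ((lm + ls) * C + 1) * (n * Y) := by
        conv_lhs => rw [← hAD]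
        rw [hD]
        ring
      linarith

/-- The number of operations of the algorithm. -/
noncomputable def totalCost (M : ℕ → ℝ) (lm ls li c cs ci : ℝ) (n : ℕ) : ℝ :=
  (if startCoeffs cs ci n = 0 then 0 else
      li * M (startCoeffs cs ci n) + ls * M (startCoeffs cs ci n)) +
    loopCost (fun m => lm * M m) (fun m => ls * M m) c n (n - startCoeffs cs ci n) +
    (li * M n + (⌈3 + c⌉₊ * (n * 2) : ℕ) + ls * M n)

theorem totalCost_le (hM : ∀ (α : ℝ) (m n : ℕ), 1 ≤ α → 1 ≤ m → (n : ℝ) = α * (m : ℝ) →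
    α * M m ≤ M n) (hMpos : ∀ n : ℕ, 1 ≤ n → 0 < M n) {lm ls li c cs ci : ℝ}
    (hls : 0 ≤ ls) (hli : 0 ≤ li) (hcs : 0 ≤ cs) {n : ℕ} (hn : 1 ≤ n) :
    totalCost M lm ls li c cs ci n ≤
      loopCost (fun m => lm * M m) (fun m => ls * M m) c n (n - startCoeffs cs ci n) +
        (2 * (li + ls) + 2 * ⌈3 + c⌉₊ * (1 / M 1)) * M n := by
  have hMn := hMpos n hn
  have h1 : (if startCoeffs cs ci n = 0 then 0 else
      li * M (startCoeffs cs ci n) + ls * M (startCoeffs cs ci n)) ≤ (li + ls) * M n := by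
    split_ifs with h
    · positivity
    · rw [add_mul]
      have := cost_mono hMpos hM (Nat.pos_of_ne_zero h) (startCoeffs_le (ci := ci) hcs n)
      gcongr
  have h2 := mul_le_mul_of_nonneg_left (le_cost hM hMpos hn)
    (by positivity : (0 : ℝ) ≤ 2 * ⌈3 + c⌉₊)
  unfold totalCost
  push_cast
  linarith

/-- Below the threshold `N` of the asymptotic bound, `log n ≤ log N` and `M` is at least linear, so
one constant serves for all `n ≥ 1`. -/
theorem exists_mul_log_le (hM : ∀ (α : ℝ) (m n : ℕ), 1 ≤ α → 1 ≤ m → (n : ℝ) = α * (m : ℝ) →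
    α * M m ≤ M n) (hMpos : ∀ n : ℕ, 1 ≤ n → 0 < M n)
    (h : (fun n : ℕ => (n : ℝ) * Real.log n) =O[atTop] M) :
    ∃ C : ℝ, ∀ n : ℕ, 1 ≤ n → n * Real.log n ≤ C * M n := by
  obtain ⟨C, hC⟩ := h.bound
  obtain ⟨N, hN⟩ := eventually_atTop.1 hC
  refine ⟨max C (Real.log N * (1 / M 1)), fun n hn => ?_⟩
  have hMn := hMpos n hn
  have hlog : 0 ≤ Real.log n := Real.log_natCast_nonneg n
  rcases le_or_gt N n with h | h
  · have h1 := hN n h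
    rw [Real.norm_of_nonneg hMn.le, Real.norm_of_nonneg (by positivity)] at h1
    exact h1.trans (by gcongr; exact le_max_left _ _)
  · have h0 : (0 : ℝ) < n := by exact_mod_cast hn
    have h1 : Real.log n ≤ Real.log N := Real.log_le_log h0 (by exact_mod_cast h.le)
    have h2 := le_cost hM hMpos hn
    calc n * Real.log n ≤ (1 / M 1 * M n) * Real.log N :=
          mul_le_mul h2 h1 hlog (h0.le.trans h2)
      _ = Real.log N * (1 / M 1) * M n := by ring
      _ ≤ _ := by gcongr; exact le_max_right _ _

/-- Below the threshold `N`, monotonicity bounds `M n` by the constant `M (N + 1)`, while the power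
of `n` is at least `1`. -/
theorem exists_le_rpow (hM : ∀ (α : ℝ) (m n : ℕ), 1 ≤ α → 1 ≤ m → (n : ℝ) = α * (m : ℝ) →
    α * M m ≤ M n) (hMpos : ∀ n : ℕ, 1 ≤ n → 0 < M n) {γ : ℝ} (hγ : 0 < γ)
    (h : M =O[atTop] (fun n : ℕ => (n : ℝ) ^ (1 + γ))) :
    ∃ C : ℝ, 0 ≤ C ∧ ∀ n : ℕ, 1 ≤ n → M n ≤ C * (n : ℝ) ^ (1 + γ) := by
  obtain ⟨C, hC⟩ := h.bound
  obtain ⟨N, hN⟩ := eventually_atTop.1 hC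
  have hM1 := hMpos (N + 1) (by omega)
  refine ⟨max C (M (N + 1)), le_max_of_le_right hM1.le, fun n hn => ?_⟩
  rcases le_or_gt N n with h | h
  · have h1 := hN n h
    rw [Real.norm_of_nonneg (hMpos n hn).le, Real.norm_of_nonneg (by positivity)] at h1
    exact h1.trans (by gcongr; exact le_max_left _ _)
  · have h1 : (1 : ℝ) ≤ (n : ℝ) ^ (1 + γ) :=
      Real.one_le_rpow (by exact_mod_cast hn) (by linarith)
    calc M n ≤ M (N + 1) := cost_mono hMpos hM hn (by omega)
      _ ≤ M (N + 1) * (n : ℝ) ^ (1 + γ) := le_mul_of_one_le_right hM1.le h1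
      _ ≤ _ := by gcongr; exact le_max_right _ _

theorem exists_totalCost_le_log
    (hM : ∀ (α : ℝ) (m n : ℕ), 1 ≤ α → 1 ≤ m → (n : ℝ) = α * (m : ℝ) → α * M m ≤ M n)
    (hMpos : ∀ n : ℕ, 1 ≤ n → 0 < M n) {lm ls li c cs ci : ℝ} (hlm : 0 ≤ lm)
    (hls : 0 ≤ ls) (hli : 0 ≤ li) (hc : 0 ≤ c) (hcs : 0 ≤ cs)
    (h : (fun n : ℕ => (n : ℝ) * Real.log n) =O[atTop] M) :
    ∃ C : ℝ, 0 ≤ C ∧ ∀ n : ℕ, 1 ≤ n → totalCost M lm ls li c cs ci n ≤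
      lm * M n * Real.logb ((c + 3) / (c + 2)) n + C * M n := by
  obtain ⟨C, hC⟩ := exists_mul_log_le hM hMpos h
  have hM1 := hMpos 1 le_rfl
  have hC0 : 0 ≤ C := by
    have h1 := hC 1 le_rfl
    simp only [Nat.cast_one, Real.log_one, mul_zero] at h1
    exact nonneg_of_mul_nonneg_left h1 hM1
  have hβ : 1 < (c + 3) / (c + 2) := by rw [one_lt_div (by positivity)]; linarith
  have hβ0 : 0 < Real.log ((c + 3) / (c + 2)) := Real.log_pos hβ
  -- In order: the linear work of logarithmically many iterations, the two additional iterations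
  -- with their middle products and linear work, the telescoped short products, and the first and
  -- last steps.
  refine ⟨C / Real.log ((c + 3) / (c + 2)) + 2 * lm + 2 * (1 / M 1) + ls +
    (2 * (li + ls) + 2 * ⌈3 + c⌉₊ * (1 / M 1)), by positivity, fun n hn => ?_⟩
  have h1 := totalCost_le (lm := lm) (c := c) (ci := ci) hM hMpos hls hli hcs hn
  have h2 := loopCost_le hM hMpos hlm hls hc hn (Nat.sub_le n (startCoeffs cs ci n))
  have h3 := le_cost hM hMpos hn
  have h4 : n * Real.logb ((c + 3) / (c + 2)) n ≤ C / Real.log ((c + 3) / (c + 2)) * M n := by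
    rw [Real.logb, mul_div_assoc', div_mul_eq_mul_div]
    exact div_le_div_of_nonneg_right (hC n hn) hβ0.le
  linarith

/-- The loop costs at most a constant times `n ^ (1 + γ)`, which the lower half of the `Θ`
hypothesis turns into `O(M n)`. -/
theorem totalCost_isBigO
    (hM : ∀ (α : ℝ) (m n : ℕ), 1 ≤ α → 1 ≤ m → (n : ℝ) = α * (m : ℝ) → α * M m ≤ M n)
    (hMpos : ∀ n : ℕ, 1 ≤ n → 0 < M n) {lm ls li c cs ci γ : ℝ} (hlm : 0 ≤ lm)
    (hls : 0 ≤ ls) (hli : 0 ≤ li) (hc : 0 ≤ c) (hcs : 0 ≤ cs) (hγ : 0 < γ)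
    (h : M =Θ[atTop] (fun n : ℕ => (n : ℝ) ^ (1 + γ))) :
    (fun n : ℕ => ((⌊totalCost M lm ls li c cs ci n⌋₊ : ℕ) : ℝ)) =O[atTop] M := by
  obtain ⟨C, hC0, hC⟩ := exists_le_rpow hM hMpos hγ h.1
  obtain ⟨A, hA⟩ := exists_loopCost_le_rpow (M := M) hlm hls hc hγ hC0 hC
  set E : ℝ := 2 * (li + ls) + 2 * ⌈3 + c⌉₊ * (1 / M 1) with hE
  have hM1 := hMpos 1 le_rfl
  have hE0 : 0 ≤ E := by positivity
  refine IsBigO.trans (g := fun n : ℕ => |A| * (n : ℝ) ^ (1 + γ) + E * M n) ?_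
    ((h.2.const_mul_left _).add ((isBigO_refl _ _).const_mul_left _))
  refine IsBigO.of_bound 1 (eventually_atTop.2 ⟨1, fun n hn => ?_⟩)
  have hMn := hMpos n hn
  have h0 : 0 ≤ |A| * (n : ℝ) ^ (1 + γ) + E * M n := by positivity
  rw [one_mul, Real.norm_of_nonneg (Nat.cast_nonneg _), Real.norm_of_nonneg h0]
  refine le_trans ?_ (Nat.floor_le h0)
  gcongr
  refine (totalCost_le hM hMpos hls hli hcs hn).trans ?_
  gcongr
  refine (hA n _ (Nat.sub_le _ _)).trans ?_
  have hn0 : (0 : ℝ) < n := by exact_mod_cast hn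
  rw [Real.rpow_add hn0, Real.rpow_one]
  gcongr
  · exact le_abs_self A
  · omega

end cost

/-! ### Correctness of the algorithm -/

theorem isDivision_inPlacePSDiv {K : Type*} [CommRing K] {M : ℕ → ℝ}
    (hMpos : ∀ n : ℕ, 1 ≤ n → 0 < M n)
    (hM : ∀ (α : ℝ) (m n : ℕ), 1 ≤ α → 1 ≤ m → (n : ℝ) = α * (m : ℝ) → α * M m ≤ M n)
    {lm ls li cm cs ci : ℝ} (hlm : 0 ≤ lm) (hls : 0 ≤ ls) (hli : 0 ≤ li)
    (hcm : 0 ≤ cm) (hcs : 0 ≤ cs) (hci : 0 ≤ ci) (hci' : ci ≤ max cm (cs + 1) / 2)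
    {mp sp inv : Routine}
    (hmp : IsMiddleProduct K mp (fun m => lm * M m) cm)
    (hsp : IsShortProduct K sp (fun m => ls * M m) cs)
    (hinv : IsInversion K inv (fun m => li * M m) ci) :
    IsDivision K (inPlacePSDiv mp sp inv cm cs ci)
      (fun _ => (inPlacePSDiv mp sp inv cm cs ci).extra +
        (inPlacePSDiv mp sp inv cm cs ci).code.regs)
      (fun n => ⌊totalCost M lm ls li (max cm cs) cs ci n⌋₊) := by
  obtain ⟨bm, hmp⟩ := hmp
  obtain ⟨bs, hsp⟩ := hsp
  obtain ⟨bi, hinv⟩ := hinv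
  have hc : 0 ≤ max cm cs := le_max_of_le_left hcm
  -- The word bound covers those of the three routines for all sizes up to `n`, and the summand `1`
  -- covers the index registers of the algorithm. The work space has length `0`, so the space is the
  -- constant number of extra and index registers.
  refine ⟨bm + bs + bi + 1, fun n hn => ⟨0, by simp, ?_⟩⟩
  intro B hB μ F G hF hG hu
  have hnB : n ≤ B := by nlinarith
  have hword : ∀ b, b ≤ bm + bs + bi + 1 → ∀ l, l ≤ n → b * (l + 1) ≤ B := fun b hb l hl =>
    (Nat.mul_le_mul hb (by omega)).trans hB
  have hmp' : ∀ l, 0 < l → l ≤ n → MiddleProductAt K mp (lm * M l) cm B l := fun l h0 hl =>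
    hmp l h0 B (hword bm (by omega) l hl)
  have hsp' : ∀ l, 0 < l → l ≤ n → ShortProductAt K sp (ls * M l) cs B l := fun l h0 hl =>
    hsp l h0 B (hword bs (by omega) l hl)
  have hinv' : ∀ l, 0 < l → l ≤ n → InversionAt K inv (li * M l) ci B l := fun l h0 hl =>
    hinv l h0 B (hword bi (by omega) l hl)
  set s := max mp.extra (max sp.extra inv.extra) with hs
  have hem : mp.extra ≤ s := le_max_left _ _
  have hes : sp.extra ≤ s := (le_max_left _ _).trans (le_max_right _ _)
  have hei : inv.extra ≤ s := (le_max_right _ _).trans (le_max_right _ _)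
  set E := (inPlacePSDiv mp sp inv cm cs ci).extra with hE
  have hE' : E = s + 1 + 2 * ⌈3 + max cm cs⌉₊
      + ⌊max ci cs * (⌈3 + max cm cs⌉₊ : ℝ)⌋₊ := rfl
  suffices h : WP B (shape n n n 0 E) (inPlacePSDiv mp sp inv cm cs ci).code ⟨μ, initIdx n⟩
      fun τ t => (∃ Q : K[X], Holds τ.mem .out n Q ∧ X ^ n ∣ F - G * Q) ∧
        (t : ℝ) ≤ totalCost M lm ls li (max cm cs) cs ci n by
    obtain ⟨τ, t, h1, ⟨Q, h2, h3⟩, h4⟩ := h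
    exact ⟨τ, t, Q, h1, h2, h3, Nat.le_floor h4⟩
  refine WP.seq (WP.start (cm := cm) (Ts := fun m => ls * M m) (Ti := fun m => li * M m) hn hcm
    hcs hci hci' hnB rfl rfl rfl (by show _ ≤ E; omega) (by show _ ≤ E; omega) hsp' hinv'
    (by simp [initIdx]) hF.2 hG.2 hu) ?_
  rintro τ t ⟨⟨R, hR, hτ⟩, ht⟩
  have hnew := newCoeffs_le_startCoeffs hcm hcs hci' n
  have hle := startCoeffs_le (ci := ci) hcs n
  refine WP.assign_seq (v := newCoeffs (max cm cs) (n - startCoeffs cs ci n))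
    (by simp [IExp.eval, Alg.n, Alg.k, hτ.idx_zero, hτ.idx_one, newCoeffs]) (by omega) ?_
  refine WP.seq (WP.mainLoop (F := F) (Tm := fun m => lm * M m) (Ts := fun m => ls * M m) hcm hcs hnB
    rfl rfl rfl (by show _ ≤ E; omega) (by show _ ≤ E; omega) hmp' hsp'
    (fun l hl => mul_nonneg hlm (hMpos l hl).le) hR _ (startCoeffs cs ci n) _ rfl hnew
    ?_ (by simp [Store.setIdx])) ?_
  · obtain ⟨i0, i1, h⟩ := hτ
    exact ⟨by simp [Store.setIdx, i0], by simp [Store.setIdx, i1], h, ‹_›, ‹_›, ‹_›, ‹_›⟩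
  · rintro υ t' ⟨⟨k, hυ, hk⟩, ht'⟩
    have hkn := hυ.lt
    rw [newCoeffs_eq_zero hc] at hk
    -- The loop stops with fewer than `3 + c` missing coefficients, so the fixed number of extra
    -- registers is enough and the inner products cost `O(n)`.
    have hl : n - k ≤ ⌈3 + max cm cs⌉₊ := by
      have h1 : ((n - k : ℕ) : ℝ) ≤ ⌈3 + max cm cs⌉₊ := hk.le.trans (Nat.le_ceil _)
      exact_mod_cast h1
    have hfl : ∀ a, 0 ≤ a → a ≤ max ci cs → ⌊a * ((n - k : ℕ) : ℝ)⌋₊ ≤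
        ⌊max ci cs * (⌈3 + max cm cs⌉₊ : ℝ)⌋₊ := fun a ha hac => by gcongr
    have h1 := hfl cs hcs (le_max_right _ _)
    have h2 := hfl ci hci (le_max_left _ _)
    refine (WP.finish (l := n - k) (s := s) hnB rfl rfl rfl hes hei (by show _ ≤ E; omega)
      (by show _ ≤ E; omega) (by omega) (hsp' _ (by omega) (by omega))
      (hinv' _ (by omega) (by omega)) hυ hu).mono ?_
    rintro ω t'' ⟨hω, ht''⟩
    refine ⟨hω, ?_⟩
    have h3 := cost_mono hMpos hM (m := n - k) (n := n) (by omega) (by omega)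
    have h4 := mul_le_mul_of_nonneg_left h3 hls
    have h5 := mul_le_mul_of_nonneg_left h3 hli
    have h6 : (((n - k) * (k * 2) : ℕ) : ℝ) ≤ (⌈3 + max cm cs⌉₊ * (n * 2) : ℕ) := by
      exact_mod_cast Nat.mul_le_mul hl (by omega)
    rw [totalCost]
    push_cast at *
    linarith

end PSDiv

/-! ### The main theorem -/

theorem mainTheorem2 {K : Type*} [CommRing K]
    -- the multiplication cost
    (M : ℕ → ℝ) (hMpos : ∀ n : ℕ, 1 ≤ n → 0 < M n)
    (hM : ∀ (α : ℝ) (m n : ℕ), 1 ≤ α → 1 ≤ m → (n : ℝ) = α * (m : ℝ) → α * M m ≤ M n)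
    -- the subroutines for middle products, short products and inversion
    (lm ls li cm cs ci : ℝ) (hlm : 1 ≤ lm) (hls : 1 ≤ ls) (hli : 0 ≤ li)
    (hcm : 0 ≤ cm) (hcs : 0 ≤ cs) (hci : 0 ≤ ci) (hci' : ci ≤ max cm (cs + 1) / 2)
    (mp sp inv : PSDiv.Routine)
    (hmp : PSDiv.IsMiddleProduct K mp (fun m => lm * M m) cm)
    (hsp : PSDiv.IsShortProduct K sp (fun m => ls * M m) cs)
    (hinv : PSDiv.IsInversion K inv (fun m => li * M m) ci) :
    -- the generalized Karp–Markstein step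
    (∀ (F G : PowerSeries K) (k l : ℕ) (Q H : Polynomial K), 0 < l → l ≤ k →
      Q.degree < (k : WithBot ℕ) → H.degree < (l : WithBot ℕ) →
      (PowerSeries.X : PowerSeries K) ^ k ∣ F - G * (Q : PowerSeries K) →
      (PowerSeries.X : PowerSeries K) ^ l ∣ 1 - G * (H : PowerSeries K) →
      (PowerSeries.X : PowerSeries K) ^ (k + l) ∣
        F - G * ((Q + Polynomial.X ^ k * PSDiv.shortProduct l H
          (PSDiv.chunk (fun i => PowerSeries.coeff i F) k (k + l)
            - PSDiv.middleProduct l k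
                (PSDiv.chunk (fun i => PowerSeries.coeff i G) 1 (k + l)) Q) :
            Polynomial K) : PowerSeries K)) ∧
    -- correctness, constant extra space, and number of operations
    ∃ (S : ℕ) (T : ℕ → ℕ),
      PSDiv.IsDivision K (PSDiv.inPlacePSDiv mp sp inv cm cs ci) (fun _ => S) T ∧
      ((fun n : ℕ => (n : ℝ) * Real.log n) =O[atTop] M →
        ∃ C : ℝ, ∀ n : ℕ, 1 ≤ n →
          (T n : ℝ) ≤ lm * M n * Real.logb ((max cm cs + 3) / (max cm cs + 2)) n + C * M n) ∧
      (∀ γ : ℝ, 0 < γ → γ ≤ 1 → M =Θ[atTop] (fun n : ℕ => (n : ℝ) ^ (1 + γ)) →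
        (fun n : ℕ => (T n : ℝ)) =O[atTop] M) := by
  have hlm0 : 0 ≤ lm := zero_le_one.trans hlm
  have hls0 : 0 ≤ ls := zero_le_one.trans hls
  have hc : 0 ≤ max cm cs := le_max_of_le_left hcm
  refine ⟨fun F G k l Q H _ _ hQ _ hF hH => PSDiv.karpMarkstein F G k l Q H hQ hF hH, _, _,
    PSDiv.isDivision_inPlacePSDiv hMpos hM hlm0 hls0 hli hcm hcs hci hci' hmp hsp hinv, ?_, ?_⟩
  · intro h
    obtain ⟨C, hC0, hC⟩ := PSDiv.exists_totalCost_le_log (lm := lm) (ls := ls) (li := li)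
      (c := max cm cs) (cs := cs) (ci := ci) hM hMpos hlm0 hls0 hli hc hcs h
    refine ⟨C, fun n hn => ?_⟩
    have hMn := hMpos n hn
    have hβ : 1 < (max cm cs + 3) / (max cm cs + 2) := by
      rw [one_lt_div (by positivity)]
      linarith
    have hlog := Real.logb_nonneg hβ (by exact_mod_cast hn : (1 : ℝ) ≤ n)
    -- The operation count is the integer part of `totalCost`; nonnegativity of the bound lets the
    -- integer part be dropped.
    refine le_trans ?_ (Nat.floor_le (add_nonneg (mul_nonneg (mul_nonneg hlm0 hMn.le) hlog)
      (mul_nonneg hC0 hMn.le)))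
    exact_mod_cast Nat.floor_le_floor (hC n hn)
  · intro γ hγ _ h
    exact PSDiv.totalCost_isBigO hM hMpos hlm0 hls0 hli hc hcs hγ h
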